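/- Let $Y_{4,-4},\dots,Y_{4,4}$ be the standard real spherical harmonics of degree 4 on the unit sphere $S^2\subset\mathbb R^3$, orthonormal for the surface measure, i.e., with $r^2=x^2+y^2+z^2$, $$Y_{4,-4}=\tfrac34\sqrt{\tfrac{35}{\pi}}\,xy(x^2-y^2),\quad Y_{4,-3}=\tfrac34\sqrt{\tfrac{35}{2\pi}}\,yz(3x^2-y^2),\quad Y_{4,-2}=\tfrac34\sqrt{\tfrac5\pi}\,xy(7z^2-r^2),$$ $$Y_{4,-1}=\tfrac34\sqrt{\tfrac5{2\pi}}\,yz(7z^2-3r^2),\quad Y_{4,0}=\tfrac3{16}\sqrt{\tfrac1\pi}\,(35z^4-30z^2r^2+3r^4),\quad Y_{4,1}=\tfrac34\sqrt{\tfrac5{2\pi}}\,xz(7z^2-3r^2),$$ $$Y_{4,2}=\tfrac38\sqrt{\tfrac5\pi}\,(x^2-y^2)(7z^2-r^2),\quad Y_{4,3}=\tfrac34\sqrt{\tfrac{35}{2\pi}}\,xz(x^2-3y^2),\quad Y_{4,4}=\tfrac3{16}\sqrt{\tfrac{35}\pi}\,(x^4-6x^2y^2+y^4),$$ and for $a=(a_1,\dots,a_9)^T\in\mathbb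 R^9$ put $h_a=\sum_{i=1}^9 a_iY_{4,i-5}$. Call $h_a$ normalized if $\int_{S^2}h_a^2\,d\sigma=1$, and say that $h_a$ has octahedral symmetry if it is invariant under all 24 rotations of some regular octahedron centred at the origin. Let $S_1,\dots,S_5$ be the following $9\times 9$ matrices; for $S_2,\dots,S_5$, only the nonzero entries $(i,j)$ with $i\le j$ are listed, and the entry $(j,i)$ equals the entry $(i,j)$: - $S_1=\sqrt2\,\mathrm{diag}(28,7,-8,-17,-20,-17,-8,7,28)$; - $S_2=\sqrt3\,M$ with $M_{12}=14$, $M_{23}=5\sqrt7$, $M_{34}=9$, $M_{56}=2\sqrt5$, $M_{67}=9$, $M_{78}=5\sqrt7$, $M_{89}=14$; - $S_3=\sqrt3\,M$ with $M_{18}=14$, $M_{27}=5\sqrt7$, $M_{29}=-14$, $M_{36}=9$, $M_{38}=-5\sqrt7$, $M_{45}=2\sqrt5$, $M_{47}=-9$; - $S_4=\sqrt6\,M$ with $M_{13}=2\sqrt7$, $M_{24}=3\sqrt7$, $M_{44}=10$, $M_{57}=6\sqrt5$, $M_{66}=-10$, $M_{68}=3\sqrt7$, $M_{79}=2\sqrt7$;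 - $S_5=\sqrt6\,M$ with $M_{17}=2\sqrt7$, $M_{26}=3\sqrt7$, $M_{35}=6\sqrt5$, $M_{39}=-2\sqrt7$, $M_{46}=-10$, $M_{48}=-3\sqrt7$. Let $R_z(\gamma)$ be the $9\times9$ matrix with $(R_z)_{55}=1$ and, for $k=1,\dots,4$, $(R_z)_{5-k,5-k}=(R_z)_{5+k,5+k}=\cos k\gamma$, $(R_z)_{5-k,5+k}=\sin k\gamma$, $(R_z)_{5+k,5-k}=-\sin k\gamma$, all other entries being $0$. Let $$X=\frac18\begin{bmatrix}0&0&0&0&0&2\sqrt{14}&0&-2\sqrt2&0\\0&-6&0&2\sqrt7&0&0&0&0&0\\0&0&0&0&0&2\sqrt2&0&2\sqrt{14}&0\\0&2\sqrt7&0&6&0&0&0&0&0\\0&0&0&0&3&0&2\sqrt5&0&\sqrt{35}\\-2\sqrt{14}&0&-2\sqrt2&0&0&0&0&0&0\\0&0&0&0&2\sqrt5&0&4&0&-2\sqrt7\\2\sqrt2&0&-2\sqrt{14}&0&0&0&0&0&0\\0&0&0&0&\sqrt{35}&0&-2\sqrt7&0&1\end{bmatrix}$$ (the rotation by $\pi/2$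 about the $x$-axis acting on coordinate vectors), $R_y(\beta)=X\,R_z(\beta)\,X^T$, $R_x(\alpha)=R_y(\pi/2)^T R_z(\alpha)R_y(\pi/2)$, and $\tilde a=(0,0,0,0,\sqrt{7/12},0,0,0,\sqrt{5/12})^T$. Then $S_1,\dots,S_5$ are symmetric, and for every $a\in\mathbb R^9$ the following are equivalent: 1. $h_a$ is normalized and has octahedral symmetry; 2. $a^Ta=1$ and $a^TS_ka=0$ for $k=1,\dots,5$; 3. $a=R_x(\alpha)R_y(\beta)R_z(\gamma)\tilde a$ or $a=-R_x(\alpha)R_y(\beta)R_z(\gamma)\tilde a$ for some $\alpha,\beta,\gamma\in\mathbb R$. -/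

import Mathlib

open Matrix MeasureTheory

noncomputable section

namespace OctahedralHarmonics

/-- Three-dimensional Euclidean space. -/
abbrev E3 : Type := EuclideanSpace ℝ (Fin 3)

/-- The unit sphere in three-dimensional Euclidean space. -/
abbrev S2 : Type := Metric.sphere (0 : E3) 1

/-- The standard real spherical harmonics of degree 4 (orthonormal for the surface measure of the
unit sphere), written in Cartesian coordinates as homogeneous harmonic polynomials; the entry with
index `i` is `Y_{4, i - 4}`. -/
def basisY (i : Fin 9) (p : S2) : ℝ :=
  let x : ℝ := p.1 0
  let y : ℝ := p.1 1
  let z : ℝ := p.1 2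
  let r2 : ℝ := x ^ 2 + y ^ 2 + z ^ 2
  (![3 / 4 * √(35 / Real.pi) * (x * y * (x ^ 2 - y ^ 2)),
     3 / 4 * √(35 / (2 * Real.pi)) * (y * z * (3 * x ^ 2 - y ^ 2)),
     3 / 4 * √(5 / Real.pi) * (x * y * (7 * z ^ 2 - r2)),
     3 / 4 * √(5 / (2 * Real.pi)) * (y * z * (7 * z ^ 2 - 3 * r2)),
     3 / 16 * √(1 / Real.pi) * (35 * z ^ 4 - 30 * z ^ 2 * r2 + 3 * r2 ^ 2),
     3 / 4 * √(5 / (2 * Real.pi)) * (x * z * (7 * z ^ 2 - 3 * r2)),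
     3 / 8 * √(5 / Real.pi) * ((x ^ 2 - y ^ 2) * (7 * z ^ 2 - r2)),
     3 / 4 * √(35 / (2 * Real.pi)) * (x * z * (x ^ 2 - 3 * y ^ 2)),
     3 / 16 * √(35 / Real.pi) * (x ^ 4 - 6 * x ^ 2 * y ^ 2 + y ^ 4)] : Fin 9 → ℝ) i

/-- The spherical harmonic of degree 4 with coordinate vector `a` in the standard basis. -/
def harmonic (a : Fin 9 → ℝ) (p : S2) : ℝ := ∑ i, a i * basisY i p

/-- `h` has unit `L²` norm for the surface measure of the unit sphere (of total mass `4π`). -/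
def IsNormalized (h : S2 → ℝ) : Prop :=
  ∫ p, h p ^ 2 ∂(volume : Measure E3).toSphere = 1

/-- The six vertices `±e₁, ±e₂, ±e₃` of the standard regular octahedron. -/
def octahedronVertices : Set (Fin 3 → ℝ) :=
  {v | ∃ i : Fin 3, v = Pi.single i 1 ∨ v = Pi.single i (-1)}

/-- The rotation group of the standard octahedron: the rotations that map the set of its vertices
to itself. -/
def octahedralRotations : Set (Matrix (Fin 3) (Fin 3) ℝ) :=
  {Q | Q ∈ specialOrthogonalGroup (Fin 3) ℝ ∧
    (fun v => Q *ᵥ v) '' octahedronVertices = octahedronVertices}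

/-- `h` has octahedral symmetry: it is invariant under all rotations of some regular octahedron
centred at the origin, namely of the image of the standard one under a rotation `P`. -/
def HasOctahedralSymmetry (h : S2 → ℝ) : Prop :=
  ∃ P ∈ specialOrthogonalGroup (Fin 3) ℝ, ∀ Q ∈ octahedralRotations, ∀ p q : S2,
    q.1.ofLp = (P * Q * Pᵀ) *ᵥ p.1.ofLp → h q = h p

/-- The matrix of a rotation about the `z`-axis on coordinate vectors. -/
def Rz (γ : ℝ) : Matrix (Fin 9) (Fin 9) ℝ :=
  let c (k : ℝ) : ℝ := Real.cos (k * γ)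
  let s (k : ℝ) : ℝ := Real.sin (k * γ)
  !![c 4, 0, 0, 0, 0, 0, 0, 0, s 4;
     0, c 3, 0, 0, 0, 0, 0, s 3, 0;
     0, 0, c 2, 0, 0, 0, s 2, 0, 0;
     0, 0, 0, c 1, 0, s 1, 0, 0, 0;
     0, 0, 0, 0, 1, 0, 0, 0, 0;
     0, 0, 0, -s 1, 0, c 1, 0, 0, 0;
     0, 0, -s 2, 0, 0, 0, c 2, 0, 0;
     0, -s 3, 0, 0, 0, 0, 0, c 3, 0;
     -s 4, 0, 0, 0, 0, 0, 0, 0, c 4]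

/-- The matrix of the rotation by `π / 2` about the `x`-axis on coordinate vectors. -/
def RxHalfPi : Matrix (Fin 9) (Fin 9) ℝ :=
  (1 / 8 : ℝ) •
  !![0, 0, 0, 0, 0, 2 * √14, 0, -2 * √2, 0;
     0, -6, 0, 2 * √7, 0, 0, 0, 0, 0;
     0, 0, 0, 0, 0, 2 * √2, 0, 2 * √14, 0;
     0, 2 * √7, 0, 6, 0, 0, 0, 0, 0;
     0, 0, 0, 0, 3, 0, 2 * √5, 0, √35;
     -2 * √14, 0, -2 * √2, 0, 0, 0, 0, 0, 0;
     0, 0, 0, 0, 2 * √5, 0, 4, 0, -2 * √7;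
     2 * √2, 0, -2 * √14, 0, 0, 0, 0, 0, 0;
     0, 0, 0, 0, √35, 0, -2 * √7, 0, 1]

/-- The matrix of a rotation about the `y`-axis on coordinate vectors. -/
def Ry (β : ℝ) : Matrix (Fin 9) (Fin 9) ℝ := RxHalfPi * Rz β * RxHalfPiᵀ

/-- The matrix of a rotation about the `x`-axis on coordinate vectors. -/
def Rx (α : ℝ) : Matrix (Fin 9) (Fin 9) ℝ :=
  (Ry (Real.pi / 2))ᵀ * Rz α * Ry (Real.pi / 2)

/-- The coordinate vector of the reference harmonic. -/
def refVec : Fin 9 → ℝ := ![0, 0, 0, 0, √(7 / 12), 0, 0, 0, √(5 / 12)]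

/-- The matrix `S₁`. -/
def S₁ : Matrix (Fin 9) (Fin 9) ℝ :=
  √2 •
  !![28, 0, 0, 0, 0, 0, 0, 0, 0;
     0, 7, 0, 0, 0, 0, 0, 0, 0;
     0, 0, -8, 0, 0, 0, 0, 0, 0;
     0, 0, 0, -17, 0, 0, 0, 0, 0;
     0, 0, 0, 0, -20, 0, 0, 0, 0;
     0, 0, 0, 0, 0, -17, 0, 0, 0;
     0, 0, 0, 0, 0, 0, -8, 0, 0;
     0, 0, 0, 0, 0, 0, 0, 7, 0;
     0, 0, 0, 0, 0, 0, 0, 0, 28]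

/-- The matrix `S₂`. -/
def S₂ : Matrix (Fin 9) (Fin 9) ℝ :=
  √3 •
  !![0, 14, 0, 0, 0, 0, 0, 0, 0;
     14, 0, 5 * √7, 0, 0, 0, 0, 0, 0;
     0, 5 * √7, 0, 9, 0, 0, 0, 0, 0;
     0, 0, 9, 0, 0, 0, 0, 0, 0;
     0, 0, 0, 0, 0, 2 * √5, 0, 0, 0;
     0, 0, 0, 0, 2 * √5, 0, 9, 0, 0;
     0, 0, 0, 0, 0, 9, 0, 5 * √7, 0;
     0, 0, 0, 0, 0, 0, 5 * √7, 0, 14;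
     0, 0, 0, 0, 0, 0, 0, 14, 0]

/-- The matrix `S₃`. -/
def S₃ : Matrix (Fin 9) (Fin 9) ℝ :=
  √3 •
  !![0, 0, 0, 0, 0, 0, 0, 14, 0;
     0, 0, 0, 0, 0, 0, 5 * √7, 0, -14;
     0, 0, 0, 0, 0, 9, 0, -5 * √7, 0;
     0, 0, 0, 0, 2 * √5, 0, -9, 0, 0;
     0, 0, 0, 2 * √5, 0, 0, 0, 0, 0;
     0, 0, 9, 0, 0, 0, 0, 0, 0;
     0, 5 * √7, 0, -9, 0, 0, 0, 0, 0;
     14, 0, -5 * √7, 0, 0, 0, 0, 0, 0;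
     0, -14, 0, 0, 0, 0, 0, 0, 0]

/-- The matrix `S₄`. -/
def S₄ : Matrix (Fin 9) (Fin 9) ℝ :=
  √6 •
  !![0, 0, 2 * √7, 0, 0, 0, 0, 0, 0;
     0, 0, 0, 3 * √7, 0, 0, 0, 0, 0;
     2 * √7, 0, 0, 0, 0, 0, 0, 0, 0;
     0, 3 * √7, 0, 10, 0, 0, 0, 0, 0;
     0, 0, 0, 0, 0, 0, 6 * √5, 0, 0;
     0, 0, 0, 0, 0, -10, 0, 3 * √7, 0;
     0, 0, 0, 0, 6 * √5, 0, 0, 0, 2 * √7;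
     0, 0, 0, 0, 0, 3 * √7, 0, 0, 0;
     0, 0, 0, 0, 0, 0, 2 * √7, 0, 0]

/-- The matrix `S₅`. -/
def S₅ : Matrix (Fin 9) (Fin 9) ℝ :=
  √6 •
  !![0, 0, 0, 0, 0, 0, 2 * √7, 0, 0;
     0, 0, 0, 0, 0, 3 * √7, 0, 0, 0;
     0, 0, 0, 0, 6 * √5, 0, 0, 0, -2 * √7;
     0, 0, 0, 0, 0, -10, 0, -3 * √7, 0;
     0, 0, 6 * √5, 0, 0, 0, 0, 0, 0;
     0, 3 * √7, 0, -10, 0, 0, 0, 0, 0;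
     2 * √7, 0, 0, 0, 0, 0, 0, 0, 0;
     0, 0, 0, -3 * √7, 0, 0, 0, 0, 0;
     0, 0, -2 * √7, 0, 0, 0, 0, 0, 0]

/-- The family of the five matrices `S₁, …, S₅`. -/
def S (k : Fin 5) : Matrix (Fin 9) (Fin 9) ℝ := ![S₁, S₂, S₃, S₄, S₅] k

end OctahedralHarmonics

end

noncomputable section

namespace OctahedralHarmonics

set_option linter.unusedSimpArgs false

lemma sum_univ_nine (f : Fin 9 → ℝ) :
    ∑ i, f i = f 0 + f 1 + f 2 + f 3 + f 4 + f 5 + f 6 + f 7 + f 8 := by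
  rw [Fin.sum_univ_castSucc, Fin.sum_univ_eight]; rfl

/-- The harmonic polynomial of degree 4 on `ℝ³` with coordinate vector `a`, up to the factor
`3 / (16 √π)`. -/
def quarticForm (a : Fin 9 → ℝ) (v : Fin 3 → ℝ) : ℝ :=
  let x := v 0
  let y := v 1
  let z := v 2
  let r2 := x ^ 2 + y ^ 2 + z ^ 2
  a 0 * (4 * √5 * √7 * (x * y * (x ^ 2 - y ^ 2)))
    + a 1 * (2 * √2 * √5 * √7 * (y * z * (3 * x ^ 2 - y ^ 2)))
    + a 2 * (4 * √5 * (x * y * (7 * z ^ 2 - r2)))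
    + a 3 * (2 * √2 * √5 * (y * z * (7 * z ^ 2 - 3 * r2)))
    + a 4 * (35 * z ^ 4 - 30 * z ^ 2 * r2 + 3 * r2 ^ 2)
    + a 5 * (2 * √2 * √5 * (x * z * (7 * z ^ 2 - 3 * r2)))
    + a 6 * (2 * √5 * ((x ^ 2 - y ^ 2) * (7 * z ^ 2 - r2)))
    + a 7 * (2 * √2 * √5 * √7 * (x * z * (x ^ 2 - 3 * y ^ 2)))
    + a 8 * (√5 * √7 * (x ^ 4 - 6 * x ^ 2 * y ^ 2 + y ^ 4))

lemma sqrt_thirtyFive : √(35 : ℝ) = √5 * √7 := by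
  rw [← Real.sqrt_mul (by norm_num)]; norm_num

lemma sqrt_fourteen : √(14 : ℝ) = √2 * √7 := by
  rw [← Real.sqrt_mul (by norm_num)]; norm_num

lemma sqrt_div_two_mul (x y : ℝ) (hx : 0 ≤ x) : √(x / (2 * y)) = √2 / 2 * (√x / √y) := by
  rw [Real.sqrt_div hx, Real.sqrt_mul (by norm_num)]
  have h : √(2 : ℝ) ^ 2 = 2 := Real.sq_sqrt (by norm_num)
  have h0 : √(2 : ℝ) ≠ 0 := by positivity
  rcases eq_or_ne (√y) 0 with hy | hy
  · simp [hy]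
  · field_simp
    linear_combination (-√x) * h

lemma harmonic_eq (a : Fin 9 → ℝ) (p : S2) :
    harmonic a p = 3 / (16 * √Real.pi) * quarticForm a p.1.ofLp := by
  have hp : √Real.pi ≠ 0 := (Real.sqrt_pos.2 Real.pi_pos).ne'
  simp only [harmonic, sum_univ_nine, basisY, quarticForm]
  simp only [Matrix.cons_val, sqrt_div_two_mul _ _ (show (0 : ℝ) ≤ 5 by norm_num),
    sqrt_div_two_mul _ _ (show (0 : ℝ) ≤ 35 by norm_num),
    Real.sqrt_div (show (0 : ℝ) ≤ 5 by norm_num), Real.sqrt_div (show (0 : ℝ) ≤ 35 by norm_num),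
    Real.sqrt_div (show (0 : ℝ) ≤ 1 by norm_num), sqrt_thirtyFive, Real.sqrt_one]
  field_simp
  ring

/-- The rotation of `ℝ³` about the `z`-axis. -/
def rotZ (γ : ℝ) : Matrix (Fin 3) (Fin 3) ℝ :=
  !![Real.cos γ, -Real.sin γ, 0; Real.sin γ, Real.cos γ, 0; 0, 0, 1]

/-- The rotation of `ℝ³` by `π / 2` about the `x`-axis. -/
def rotXHalfPi : Matrix (Fin 3) (Fin 3) ℝ := !![1, 0, 0; 0, 0, -1; 0, 1, 0]

lemma mulVec_three (M : Matrix (Fin 3) (Fin 3) ℝ) (v : Fin 3 → ℝ) :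
    M *ᵥ v = ![M 0 0 * v 0 + M 0 1 * v 1 + M 0 2 * v 2, M 1 0 * v 0 + M 1 1 * v 1 + M 1 2 * v 2,
      M 2 0 * v 0 + M 2 1 * v 1 + M 2 2 * v 2] := by
  ext i
  fin_cases i <;> simp [Matrix.mulVec, dotProduct, Fin.sum_univ_three]

lemma rotZ_mulVec (γ : ℝ) (v : Fin 3 → ℝ) :
    rotZ γ *ᵥ v = ![Real.cos γ * v 0 - Real.sin γ * v 1, Real.sin γ * v 0 + Real.cos γ * v 1,
      v 2] := by
  rw [mulVec_three]; simp [rotZ, sub_eq_add_neg]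

lemma rotXHalfPi_mulVec (v : Fin 3 → ℝ) : rotXHalfPi *ᵥ v = ![v 0, -v 2, v 1] := by
  rw [mulVec_three]; simp [rotXHalfPi]

lemma Rz_mulVec (γ : ℝ) (a : Fin 9 → ℝ) :
    Rz γ *ᵥ a =
      ![Real.cos (4 * γ) * a 0 + Real.sin (4 * γ) * a 8,
        Real.cos (3 * γ) * a 1 + Real.sin (3 * γ) * a 7,
        Real.cos (2 * γ) * a 2 + Real.sin (2 * γ) * a 6,
        Real.cos γ * a 3 + Real.sin γ * a 5,
        a 4,
        -Real.sin γ * a 3 + Real.cos γ * a 5,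
        -Real.sin (2 * γ) * a 2 + Real.cos (2 * γ) * a 6,
        -Real.sin (3 * γ) * a 1 + Real.cos (3 * γ) * a 7,
        -Real.sin (4 * γ) * a 0 + Real.cos (4 * γ) * a 8] := by
  ext i
  fin_cases i <;> simp [Rz, Matrix.mulVec, dotProduct, sum_univ_nine]

lemma RxHalfPi_mulVec (a : Fin 9 → ℝ) :
    RxHalfPi *ᵥ a =
      ![(√2 * √7 * a 5 - √2 * a 7) / 4,
        (-3 * a 1 + √7 * a 3) / 4,
        (√2 * a 5 + √2 * √7 * a 7) / 4,
        (√7 * a 1 + 3 * a 3) / 4,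
        (3 * a 4 + 2 * √5 * a 6 + √5 * √7 * a 8) / 8,
        (-√2 * √7 * a 0 - √2 * a 2) / 4,
        (√5 * a 4 + 2 * a 6 - √7 * a 8) / 4,
        (√2 * a 0 - √2 * √7 * a 2) / 4,
        (√5 * √7 * a 4 - 2 * √7 * a 6 + a 8) / 8] := by
  ext i
  fin_cases i <;>
    simp [RxHalfPi, Matrix.mulVec, dotProduct, sum_univ_nine, sqrt_fourteen, sqrt_thirtyFive] <;>
    ring

lemma sq_sqrt_two : √(2 : ℝ) ^ 2 = 2 := Real.sq_sqrt (by norm_num)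
lemma sq_sqrt_five : √(5 : ℝ) ^ 2 = 5 := Real.sq_sqrt (by norm_num)
lemma sq_sqrt_seven : √(7 : ℝ) ^ 2 = 7 := Real.sq_sqrt (by norm_num)

lemma cube_sqrt_two : √(2 : ℝ) ^ 3 = 2 * √2 := by rw [pow_succ, sq_sqrt_two]
lemma cube_sqrt_five : √(5 : ℝ) ^ 3 = 5 * √5 := by rw [pow_succ, sq_sqrt_five]
lemma cube_sqrt_seven : √(7 : ℝ) ^ 3 = 7 * √7 := by rw [pow_succ, sq_sqrt_seven]

lemma quarticForm_Rz (γ : ℝ) (a : Fin 9 → ℝ) (v : Fin 3 → ℝ) :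
    quarticForm (Rz γ *ᵥ a) (rotZ γ *ᵥ v) = quarticForm a v := by
  have c2 : Real.cos (2 * γ) = Real.cos γ ^ 2 - Real.sin γ ^ 2 := Real.cos_two_mul' γ
  have s2 : Real.sin (2 * γ) = 2 * Real.sin γ * Real.cos γ := Real.sin_two_mul γ
  have c3 : Real.cos (3 * γ) = Real.cos γ ^ 3 - 3 * Real.cos γ * Real.sin γ ^ 2 := by
    rw [show 3 * γ = 2 * γ + γ by ring, Real.cos_add, c2, s2]; ring
  have s3 : Real.sin (3 * γ) = 3 * Real.cos γ ^ 2 * Real.sin γ - Real.sin γ ^ 3 := by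
    rw [show 3 * γ = 2 * γ + γ by ring, Real.sin_add, c2, s2]; ring
  have c4 : Real.cos (4 * γ) =
      Real.cos γ ^ 4 - 6 * Real.cos γ ^ 2 * Real.sin γ ^ 2 + Real.sin γ ^ 4 := by
    rw [show 4 * γ = 2 * γ + 2 * γ by ring, Real.cos_add, c2, s2]; ring
  have s4 : Real.sin (4 * γ) =
      4 * Real.cos γ ^ 3 * Real.sin γ - 4 * Real.cos γ * Real.sin γ ^ 3 := by
    rw [show 4 * γ = 2 * γ + 2 * γ by ring, Real.sin_add, c2, s2]; ring
  rw [Rz_mulVec, rotZ_mulVec, c2, s2, c3, s3, c4, s4]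
  have hr := Real.cos_sq_add_sin_sq γ
  generalize Real.cos γ = c at *
  generalize Real.sin γ = s at *
  have hxy : (c * v 0 - s * v 1) ^ 2 + (s * v 0 + c * v 1) ^ 2 + v 2 ^ 2
      = v 0 ^ 2 + v 1 ^ 2 + v 2 ^ 2 := by linear_combination (v 0 ^ 2 + v 1 ^ 2) * hr
  simp only [quarticForm, Matrix.cons_val, hxy]
  set x := v 0
  set y := v 1
  set z := v 2
  set r2 := x ^ 2 + y ^ 2 + z ^ 2
  set N := c ^ 2 + s ^ 2
  have h1 : N - 1 = 0 := by rw [hr, sub_self]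
  simp only [N] at h1
  linear_combination
    ((a 3 * y + a 5 * x) * (2 * √2 * √5 * (z * (7 * z ^ 2 - 3 * r2)))
      + (a 2 * (2 * x * y) + a 6 * (x ^ 2 - y ^ 2)) * (2 * √5 * (7 * z ^ 2 - r2)) * (N + 1)
      + (a 1 * (y * (3 * x ^ 2 - y ^ 2)) + a 7 * (x * (x ^ 2 - 3 * y ^ 2)))
        * (2 * √2 * √5 * √7 * z) * (N ^ 2 + N + 1)
      + (a 0 * (4 * (x * y * (x ^ 2 - y ^ 2))) + a 8 * (x ^ 4 - 6 * x ^ 2 * y ^ 2 + y ^ 4))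
        * (√5 * √7) * ((N + 1) * (N ^ 2 + 1))) * h1

lemma quarticForm_RxHalfPi (a : Fin 9 → ℝ) (v : Fin 3 → ℝ) :
    quarticForm (RxHalfPi *ᵥ a) (rotXHalfPi *ᵥ v) = quarticForm a v := by
  rw [RxHalfPi_mulVec, rotXHalfPi_mulVec]
  simp only [quarticForm, Matrix.cons_val]
  ring_nf
  simp only [sq_sqrt_two, sq_sqrt_five, sq_sqrt_seven, cube_sqrt_two, cube_sqrt_five,
    cube_sqrt_seven]
  ring

lemma Rz_mul_transpose (γ : ℝ) : Rz γ * (Rz γ)ᵀ = 1 := by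
  have h (k : ℝ) := Real.cos_sq_add_sin_sq (k * γ)
  simp only [sq] at h
  have h' (k : ℝ) : Real.sin (k * γ) * Real.sin (k * γ) + Real.cos (k * γ) * Real.cos (k * γ) = 1 := by
    rw [add_comm, h]
  have h1 := h 1
  have h2 := h' 1
  rw [one_mul] at h1 h2
  ext i j
  fin_cases i <;> fin_cases j <;> simp [Rz, Matrix.mul_apply, sum_univ_nine, h, h', h1, h2] <;> ring

lemma RxHalfPi_mul_transpose : RxHalfPi * RxHalfPiᵀ = 1 := by
  ext i j
  fin_cases i <;> fin_cases j <;>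
    simp [RxHalfPi, Matrix.mul_apply, sum_univ_nine, sqrt_fourteen, sqrt_thirtyFive] <;>
    ring_nf <;> simp [sq_sqrt_two, sq_sqrt_five, sq_sqrt_seven] <;> ring_nf

lemma dotProduct_S₁ (a : Fin 9 → ℝ) : a ⬝ᵥ (S 0 *ᵥ a) =
    √2 * (28 * (a 0 ^ 2 + a 8 ^ 2) + 7 * (a 1 ^ 2 + a 7 ^ 2) - 8 * (a 2 ^ 2 + a 6 ^ 2)
      - 17 * (a 3 ^ 2 + a 5 ^ 2) - 20 * a 4 ^ 2) := by
  simp [S, S₁, Matrix.mulVec, dotProduct, sum_univ_nine]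
  ring

lemma dotProduct_S₂ (a : Fin 9 → ℝ) : a ⬝ᵥ (S 1 *ᵥ a) =
    2 * √3 * (14 * (a 0 * a 1 + a 8 * a 7) + 5 * √7 * (a 1 * a 2 + a 7 * a 6)
      + 9 * (a 2 * a 3 + a 6 * a 5) + 2 * √5 * (a 4 * a 5)) := by
  simp [S, S₂, Matrix.mulVec, dotProduct, sum_univ_nine]
  ring

lemma dotProduct_S₃ (a : Fin 9 → ℝ) : a ⬝ᵥ (S 2 *ᵥ a) =
    2 * √3 * (14 * (a 0 * a 7 - a 1 * a 8) + 5 * √7 * (a 1 * a 6 - a 2 * a 7)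
      + 9 * (a 2 * a 5 - a 3 * a 6) + 2 * √5 * (a 4 * a 3)) := by
  simp [S, S₃, Matrix.mulVec, dotProduct, sum_univ_nine]
  ring

lemma dotProduct_S₄ (a : Fin 9 → ℝ) : a ⬝ᵥ (S 3 *ᵥ a) =
    √6 * (4 * √7 * (a 0 * a 2 + a 8 * a 6) + 6 * √7 * (a 1 * a 3 + a 7 * a 5)
      + 10 * (a 3 ^ 2 - a 5 ^ 2) + 12 * √5 * (a 4 * a 6)) := by
  simp [S, S₄, Matrix.mulVec, dotProduct, sum_univ_nine]
  ring

lemma dotProduct_S₅ (a : Fin 9 → ℝ) : a ⬝ᵥ (S 4 *ᵥ a) =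
    √6 * (4 * √7 * (a 0 * a 6 - a 2 * a 8) + 6 * √7 * (a 1 * a 5 - a 3 * a 7)
      - 20 * (a 3 * a 5) + 12 * √5 * (a 4 * a 2)) := by
  simp [S, S₅, Matrix.mulVec, dotProduct, sum_univ_nine]
  ring

/-- The quadratic equations given by the matrices `S₁, …, S₅`. -/
def Isotropic (a : Fin 9 → ℝ) : Prop := ∀ k : Fin 5, a ⬝ᵥ (S k *ᵥ a) = 0

lemma isotropic_iff (a : Fin 9 → ℝ) : Isotropic a ↔
    28 * (a 0 ^ 2 + a 8 ^ 2) + 7 * (a 1 ^ 2 + a 7 ^ 2) - 8 * (a 2 ^ 2 + a 6 ^ 2)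
      - 17 * (a 3 ^ 2 + a 5 ^ 2) - 20 * a 4 ^ 2 = 0 ∧
    14 * (a 0 * a 1 + a 8 * a 7) + 5 * √7 * (a 1 * a 2 + a 7 * a 6)
      + 9 * (a 2 * a 3 + a 6 * a 5) + 2 * √5 * (a 4 * a 5) = 0 ∧
    14 * (a 0 * a 7 - a 1 * a 8) + 5 * √7 * (a 1 * a 6 - a 2 * a 7)
      + 9 * (a 2 * a 5 - a 3 * a 6) + 2 * √5 * (a 4 * a 3) = 0 ∧
    4 * √7 * (a 0 * a 2 + a 8 * a 6) + 6 * √7 * (a 1 * a 3 + a 7 * a 5)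
      + 10 * (a 3 ^ 2 - a 5 ^ 2) + 12 * √5 * (a 4 * a 6) = 0 ∧
    4 * √7 * (a 0 * a 6 - a 2 * a 8) + 6 * √7 * (a 1 * a 5 - a 3 * a 7)
      - 20 * (a 3 * a 5) + 12 * √5 * (a 4 * a 2) = 0 := by
  have h2 : √(2 : ℝ) ≠ 0 := by positivity
  have h3 : 2 * √(3 : ℝ) ≠ 0 := by positivity
  have h6 : √(6 : ℝ) ≠ 0 := by positivity
  simp only [Isotropic, Fin.forall_fin_succ, Fin.succ_zero_eq_one, Fin.succ_one_eq_two,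
    IsEmpty.forall_iff, and_true]
  rw [show ((2 : Fin 3).succ.succ : Fin 5) = 4 from rfl, show ((2 : Fin 4).succ : Fin 5) = 3 from rfl]
  rw [dotProduct_S₁, dotProduct_S₂, dotProduct_S₃, dotProduct_S₄, dotProduct_S₅]
  simp only [mul_eq_zero, h2, h3, h6, false_or]

lemma isotropic_Rz (γ : ℝ) {a : Fin 9 → ℝ} (ha : Isotropic a) : Isotropic (Rz γ *ᵥ a) := by
  rw [isotropic_iff] at ha ⊢
  obtain ⟨f1, f2, f3, f4, f5⟩ := ha
  have h1 := Real.cos_sq_add_sin_sq γ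
  have h2 := Real.cos_sq_add_sin_sq (2 * γ)
  have h3 := Real.cos_sq_add_sin_sq (3 * γ)
  have h4 := Real.cos_sq_add_sin_sq (4 * γ)
  have c21 := Real.cos_sub (2 * γ) γ
  have c32 := Real.cos_sub (3 * γ) (2 * γ)
  have c43 := Real.cos_sub (4 * γ) (3 * γ)
  have c31 := Real.cos_sub (3 * γ) γ
  have c42 := Real.cos_sub (4 * γ) (2 * γ)
  have s21 := Real.sin_sub (2 * γ) γ
  have s32 := Real.sin_sub (3 * γ) (2 * γ)
  have s43 := Real.sin_sub (4 * γ) (3 * γ)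
  have s31 := Real.sin_sub (3 * γ) γ
  have s42 := Real.sin_sub (4 * γ) (2 * γ)
  have c11 := Real.cos_two_mul' γ
  have s11 := Real.sin_two_mul γ
  rw [show 2 * γ - γ = γ by ring] at c21 s21
  rw [show 3 * γ - 2 * γ = γ by ring] at c32 s32
  rw [show 4 * γ - 3 * γ = γ by ring] at c43 s43
  rw [show 3 * γ - γ = 2 * γ by ring] at c31 s31
  rw [show 4 * γ - 2 * γ = 2 * γ by ring] at c42 s42
  rw [Rz_mulVec]
  simp only [Matrix.cons_val]
  refine ⟨?_, ?_, ?_, ?_, ?_⟩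
  · linear_combination f1 + 28 * (a 0 ^ 2 + a 8 ^ 2) * h4 + 7 * (a 1 ^ 2 + a 7 ^ 2) * h3
      - 8 * (a 2 ^ 2 + a 6 ^ 2) * h2 - 17 * (a 3 ^ 2 + a 5 ^ 2) * h1
  · linear_combination Real.cos γ * f2 - Real.sin γ * f3
      - 14 * ((a 0 * a 1 + a 8 * a 7) * c43 - (a 0 * a 7 - a 1 * a 8) * s43)
      - 5 * √7 * ((a 1 * a 2 + a 7 * a 6) * c32 - (a 1 * a 6 - a 2 * a 7) * s32)
      - 9 * ((a 2 * a 3 + a 6 * a 5) * c21 - (a 2 * a 5 - a 3 * a 6) * s21)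
  · linear_combination Real.sin γ * f2 + Real.cos γ * f3
      - 14 * ((a 0 * a 1 + a 8 * a 7) * s43 + (a 0 * a 7 - a 1 * a 8) * c43)
      - 5 * √7 * ((a 1 * a 2 + a 7 * a 6) * s32 + (a 1 * a 6 - a 2 * a 7) * c32)
      - 9 * ((a 2 * a 3 + a 6 * a 5) * s21 + (a 2 * a 5 - a 3 * a 6) * c21)
  · linear_combination Real.cos (2 * γ) * f4 - Real.sin (2 * γ) * f5
      - 4 * √7 * ((a 0 * a 2 + a 8 * a 6) * c42 - (a 0 * a 6 - a 2 * a 8) * s42)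
      - 6 * √7 * ((a 1 * a 3 + a 7 * a 5) * c31 - (a 1 * a 5 - a 3 * a 7) * s31)
      - 10 * ((a 3 ^ 2 - a 5 ^ 2) * c11 + 2 * a 3 * a 5 * s11)
  · linear_combination Real.sin (2 * γ) * f4 + Real.cos (2 * γ) * f5
      - 4 * √7 * ((a 0 * a 2 + a 8 * a 6) * s42 + (a 0 * a 6 - a 2 * a 8) * c42)
      - 6 * √7 * ((a 1 * a 3 + a 7 * a 5) * s31 + (a 1 * a 5 - a 3 * a 7) * c31)
      - 10 * ((a 3 ^ 2 - a 5 ^ 2) * s11 - 2 * a 3 * a 5 * c11)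

lemma isotropic_RxHalfPi_iff (a : Fin 9 → ℝ) : Isotropic (RxHalfPi *ᵥ a) ↔ Isotropic a := by
  rw [isotropic_iff, isotropic_iff, RxHalfPi_mulVec]
  simp only [Matrix.cons_val]
  set b0 := (√2 * √7 * a 5 - √2 * a 7) / 4 with hb0
  set b1 := (-3 * a 1 + √7 * a 3) / 4 with hb1
  set b2 := (√2 * a 5 + √2 * √7 * a 7) / 4 with hb2
  set b3 := (√7 * a 1 + 3 * a 3) / 4 with hb3
  set b4 := (3 * a 4 + 2 * √5 * a 6 + √5 * √7 * a 8) / 8 with hb4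
  set b5 := (-√2 * √7 * a 0 - √2 * a 2) / 4 with hb5
  set b6 := (√5 * a 4 + 2 * a 6 - √7 * a 8) / 4 with hb6
  set b7 := (√2 * a 0 - √2 * √7 * a 2) / 4 with hb7
  set b8 := (√5 * √7 * a 4 - 2 * √7 * a 6 + a 8) / 8 with hb8
  set g1 := 28 * (b0 ^ 2 + b8 ^ 2) + 7 * (b1 ^ 2 + b7 ^ 2) - 8 * (b2 ^ 2 + b6 ^ 2)
      - 17 * (b3 ^ 2 + b5 ^ 2) - 20 * b4 ^ 2 with hg1
  set g2 := 14 * (b0 * b1 + b8 * b7) + 5 * √7 * (b1 * b2 + b7 * b6)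
      + 9 * (b2 * b3 + b6 * b5) + 2 * √5 * (b4 * b5) with hg2
  set g3 := 14 * (b0 * b7 - b1 * b8) + 5 * √7 * (b1 * b6 - b2 * b7)
      + 9 * (b2 * b5 - b3 * b6) + 2 * √5 * (b4 * b3) with hg3
  set g4 := 4 * √7 * (b0 * b2 + b8 * b6) + 6 * √7 * (b1 * b3 + b7 * b5)
      + 10 * (b3 ^ 2 - b5 ^ 2) + 12 * √5 * (b4 * b6) with hg4
  set g5 := 4 * √7 * (b0 * b6 - b2 * b8) + 6 * √7 * (b1 * b5 - b3 * b7)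
      - 20 * (b3 * b5) + 12 * √5 * (b4 * b2) with hg5
  set f1 := 28 * (a 0 ^ 2 + a 8 ^ 2) + 7 * (a 1 ^ 2 + a 7 ^ 2) - 8 * (a 2 ^ 2 + a 6 ^ 2)
      - 17 * (a 3 ^ 2 + a 5 ^ 2) - 20 * a 4 ^ 2 with hf1
  set f2 := 14 * (a 0 * a 1 + a 8 * a 7) + 5 * √7 * (a 1 * a 2 + a 7 * a 6)
      + 9 * (a 2 * a 3 + a 6 * a 5) + 2 * √5 * (a 4 * a 5) with hf2
  set f3 := 14 * (a 0 * a 7 - a 1 * a 8) + 5 * √7 * (a 1 * a 6 - a 2 * a 7)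
      + 9 * (a 2 * a 5 - a 3 * a 6) + 2 * √5 * (a 4 * a 3) with hf3
  set f4 := 4 * √7 * (a 0 * a 2 + a 8 * a 6) + 6 * √7 * (a 1 * a 3 + a 7 * a 5)
      + 10 * (a 3 ^ 2 - a 5 ^ 2) + 12 * √5 * (a 4 * a 6) with hf4
  set f5 := 4 * √7 * (a 0 * a 6 - a 2 * a 8) + 6 * √7 * (a 1 * a 5 - a 3 * a 7)
      - 20 * (a 3 * a 5) + 12 * √5 * (a 4 * a 2) with hf5
  have e1 : g1 = -(f1 + 3 * f4) / 2 := by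
    simp only [hg1, hf1, hf4, hb0, hb1, hb2, hb3, hb4, hb5, hb6, hb7, hb8]
    ring_nf
    simp only [sq_sqrt_two, sq_sqrt_five, sq_sqrt_seven, cube_sqrt_two, cube_sqrt_five,
      cube_sqrt_seven]
    ring
  have e2 : g2 = -√2 / 2 * f5 := by
    simp only [hg2, hf5, hb0, hb1, hb2, hb3, hb4, hb5, hb6, hb7, hb8]
    ring_nf
    simp only [sq_sqrt_two, sq_sqrt_five, sq_sqrt_seven, cube_sqrt_two, cube_sqrt_five,
      cube_sqrt_seven]
    ring
  have e3 : g3 = -f3 := by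
    simp only [hg3, hf3, hb0, hb1, hb2, hb3, hb4, hb5, hb6, hb7, hb8]
    ring_nf
    simp only [sq_sqrt_two, sq_sqrt_five, sq_sqrt_seven, cube_sqrt_two, cube_sqrt_five,
      cube_sqrt_seven]
    ring
  have e4 : g4 = (f4 - f1) / 2 := by
    simp only [hg4, hf1, hf4, hb0, hb1, hb2, hb3, hb4, hb5, hb6, hb7, hb8]
    ring_nf
    simp only [sq_sqrt_two, sq_sqrt_five, sq_sqrt_seven, cube_sqrt_two, cube_sqrt_five,
      cube_sqrt_seven]
    ring
  have e5 : g5 = √2 * f2 := by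
    simp only [hg5, hf2, hb0, hb1, hb2, hb3, hb4, hb5, hb6, hb7, hb8]
    ring_nf
    simp only [sq_sqrt_two, sq_sqrt_five, sq_sqrt_seven, cube_sqrt_two, cube_sqrt_five,
      cube_sqrt_seven]
    ring
  have h2 : √(2 : ℝ) ≠ 0 := by positivity
  clear_value f1 f2 f3 f4 f5 g1 g2 g3 g4 g5
  subst e1 e2 e3 e4 e5
  constructor
  · rintro ⟨p1, p2, p3, p4, p5⟩
    refine ⟨by linarith, ?_, by linarith, by linarith, ?_⟩
    · simpa [h2] using p5
    · simpa [h2] using p2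
  · rintro ⟨rfl, rfl, rfl, rfl, rfl⟩
    norm_num

lemma Rz_transpose (γ : ℝ) : (Rz γ)ᵀ = Rz (-γ) := by
  ext i j
  fin_cases i <;> fin_cases j <;> simp [Rz]

lemma isotropic_Rz_iff (γ : ℝ) (a : Fin 9 → ℝ) : Isotropic (Rz γ *ᵥ a) ↔ Isotropic a := by
  refine ⟨fun h => ?_, isotropic_Rz γ⟩
  have h' := isotropic_Rz (-γ) h
  rwa [← Rz_transpose, Matrix.mulVec_mulVec, mul_eq_one_comm.1 (Rz_mul_transpose γ),
    Matrix.one_mulVec] at h'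

open Set in
lemma integral_Ioi_pow_mul_exp_neg_sq (n : ℕ) :
    ∫ r in Ioi (0 : ℝ), r ^ n * Real.exp (-r ^ 2) = 1 / 2 * Real.Gamma ((n + 1) / 2) := by
  have h := integral_rpow_mul_exp_neg_rpow (p := 2) (q := n) two_pos
    (by linarith [n.cast_nonneg (α := ℝ)])
  rw [← h]
  simp only [Real.rpow_natCast, Real.rpow_two]

/-- The moments of the function `exp (-x ^ 2)`, divided by `√π`. -/
def gaussMoment : ℕ → ℝ
  | 0 => 1
  | 1 => 0
  | n + 2 => (n + 1) / 2 * gaussMoment n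

open Set in
lemma integral_pow_mul_exp_neg_sq_of_even {n : ℕ} (hn : Even n) :
    ∫ x : ℝ, x ^ n * Real.exp (-x ^ 2) = Real.Gamma ((n + 1) / 2) := by
  have h := integral_comp_abs (f := fun x : ℝ => x ^ n * Real.exp (-x ^ 2))
  simp only [hn.pow_abs, sq_abs] at h
  rw [h, integral_Ioi_pow_mul_exp_neg_sq]
  ring

lemma integral_pow_mul_exp_neg_sq_of_odd {n : ℕ} (hn : Odd n) :
    ∫ x : ℝ, x ^ n * Real.exp (-x ^ 2) = 0 := by
  have h := integral_neg_eq_self (fun x : ℝ => x ^ n * Real.exp (-x ^ 2)) volume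
  simp only [hn.neg_pow, neg_sq, neg_mul, integral_neg] at h
  linarith

lemma integral_pow_mul_exp_neg_sq (n : ℕ) :
    ∫ x : ℝ, x ^ n * Real.exp (-x ^ 2) = √Real.pi * gaussMoment n := by
  induction n using Nat.twoStepInduction with
  | zero =>
    rw [integral_pow_mul_exp_neg_sq_of_even (by decide)]
    simp [gaussMoment, ← Real.Gamma_one_half_eq]
  | one => rw [integral_pow_mul_exp_neg_sq_of_odd odd_one, gaussMoment, mul_zero]
  | more n ih _ =>
    rw [gaussMoment, mul_left_comm, ← ih]
    rcases n.even_or_odd with hn | hn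
    · rw [integral_pow_mul_exp_neg_sq_of_even hn,
        integral_pow_mul_exp_neg_sq_of_even (hn.add (by decide)),
        ← Real.Gamma_add_one (by positivity)]
      congr 1
      push_cast
      ring
    · rw [integral_pow_mul_exp_neg_sq_of_odd hn,
        integral_pow_mul_exp_neg_sq_of_odd (hn.add_even (by decide)), mul_zero]

open Set in
lemma integral_homogeneous_mul_exp_neg_sq (f : E3 → ℝ) (n : ℕ)
    (hf : ∀ (r : ℝ) (x : E3), f (r • x) = r ^ n * f x) :
    ∫ x : E3, f x * Real.exp (-‖x‖ ^ 2) =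
      (∫ p : S2, f p ∂(volume : Measure E3).toSphere)
        * ∫ r in Ioi (0 : ℝ), r ^ (n + 2) * Real.exp (-r ^ 2) := by
  have hdim : Module.finrank ℝ E3 - 1 = 2 := by simp
  calc
    ∫ x : E3, f x * Real.exp (-‖x‖ ^ 2)
        = ∫ x : ({(0)}ᶜ : Set E3), f x.1 * Real.exp (-‖x.1‖ ^ 2) ∂(volume.comap Subtype.val) := by
      rw [integral_subtype_comap (measurableSet_singleton _).compl
        fun x : E3 ↦ f x * Real.exp (-‖x‖ ^ 2), restrict_compl_singleton]
    _ = ∫ q : S2 × Ioi (0 : ℝ), f q.1 * (q.2.1 ^ n * Real.exp (-q.2.1 ^ 2))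
          ∂(volume : Measure E3).toSphere.prod (.volumeIoiPow 2) := by
      have h := (volume : Measure E3).measurePreserving_homeomorphUnitSphereProd.integral_comp
        (Homeomorph.measurableEmbedding _)
        (fun q : S2 × Ioi (0 : ℝ) => f q.1 * (q.2.1 ^ n * Real.exp (-q.2.1 ^ 2)))
      rw [hdim] at h
      rw [← h]
      congr 1
      ext x
      have hx : ‖x.1‖ ≠ 0 := norm_ne_zero_iff.2 x.2
      simp only [homeomorphUnitSphereProd_apply_fst_coe, homeomorphUnitSphereProd_apply_snd_coe,
        hf, inv_pow]
      field_simp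
    _ = (∫ p : S2, f p ∂(volume : Measure E3).toSphere)
          * ∫ r : Ioi (0 : ℝ), r.1 ^ n * Real.exp (-r.1 ^ 2) ∂.volumeIoiPow 2 :=
      integral_prod_mul (fun p : S2 => f p)
        (fun r : Ioi (0 : ℝ) => r.1 ^ n * Real.exp (-r.1 ^ 2))
    _ = _ := by
      congr 1
      simp only [Measure.volumeIoiPow, ENNReal.ofReal]
      rw [integral_withDensity_eq_integral_smul,
        integral_subtype_comap measurableSet_Ioi
          fun a ↦ Real.toNNReal (a ^ 2) • (a ^ n * Real.exp (-a ^ 2)),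
        setIntegral_congr_fun measurableSet_Ioi fun x hx ↦ ?_]
      · simp only [NNReal.smul_def, Real.coe_toNNReal _ (sq_nonneg x), smul_eq_mul]
        ring
      · exact (measurable_subtype_coe.pow_const _).real_toNNReal

lemma integral_monomial_mul_exp_neg_sq (e : Fin 3 → ℕ) :
    ∫ x : E3, (∏ i, x i ^ e i) * Real.exp (-‖x‖ ^ 2) =
      ∏ i, (√Real.pi * gaussMoment (e i)) := by
  simp only [← integral_pow_mul_exp_neg_sq]
  rw [← integral_fintype_prod_volume_eq_prod (fun i (x : ℝ) => x ^ e i * Real.exp (-x ^ 2)),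
    ← (PiLp.volume_preserving_toLp (Fin 3)).integral_comp
      (MeasurableEquiv.toLp 2 (Fin 3 → ℝ)).measurableEmbedding]
  congr 1
  ext x
  rw [Finset.prod_mul_distrib, ← Real.exp_sum, EuclideanSpace.norm_sq_eq]
  simp

lemma integral_sphere_monomial (e : Fin 3 → ℕ) (he : ∑ i, e i = 8) :
    ∫ p : S2, ∏ i, p.1 i ^ e i ∂(volume : Measure E3).toSphere =
      64 / 945 * Real.pi * ∏ i, gaussMoment (e i) := by
  have h := integral_homogeneous_mul_exp_neg_sq (fun x => ∏ i, x i ^ e i) 8 (fun r x => by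
    simp only [PiLp.smul_apply, smul_eq_mul, mul_pow, Finset.prod_mul_distrib,
      Finset.prod_pow_eq_pow_sum, he])
  have h10 := integral_pow_mul_exp_neg_sq 10
  rw [integral_pow_mul_exp_neg_sq_of_even (by decide)] at h10
  rw [integral_monomial_mul_exp_neg_sq, integral_Ioi_pow_mul_exp_neg_sq, h10,
    Finset.prod_mul_distrib] at h
  have hp : √Real.pi ≠ 0 := (Real.sqrt_pos.2 Real.pi_pos).ne'
  have hq : √Real.pi ^ 2 = Real.pi := Real.sq_sqrt Real.pi_pos.le
  norm_num [gaussMoment] at h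
  rw [← hq]
  field_simp at h
  linear_combination (-1 / 945) * h

/-- The exponents of the monomials of degree 4 in three variables. -/
def quarticExponent (m : Fin 15) : Fin 3 → ℕ :=
  ![![4, 0, 0, 2, 2, 0, 3, 1, 1, 2, 0, 0, 3, 1, 1] m,
    ![0, 4, 0, 2, 0, 2, 1, 3, 1, 1, 3, 1, 0, 2, 0] m,
    ![0, 0, 4, 0, 2, 2, 0, 0, 2, 1, 1, 3, 1, 1, 3] m]

/-- The coefficients of `quarticForm a`. -/
def quarticCoeff (a : Fin 9 → ℝ) : Fin 15 → ℝ :=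
  ![3 * a 4 - 2 * √5 * a 6 + √5 * √7 * a 8,
    3 * a 4 + 2 * √5 * a 6 + √5 * √7 * a 8,
    8 * a 4,
    6 * a 4 - 6 * √5 * √7 * a 8,
    -24 * a 4 + 12 * √5 * a 6,
    -24 * a 4 - 12 * √5 * a 6,
    4 * √5 * √7 * a 0 - 4 * √5 * a 2,
    -4 * √5 * √7 * a 0 - 4 * √5 * a 2,
    24 * √5 * a 2,
    6 * √2 * √5 * √7 * a 1 - 6 * √2 * √5 * a 3,
    -2 * √2 * √5 * √7 * a 1 - 6 * √2 * √5 * a 3,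
    8 * √2 * √5 * a 3,
    2 * √2 * √5 * √7 * a 7 - 6 * √2 * √5 * a 5,
    -6 * √2 * √5 * √7 * a 7 - 6 * √2 * √5 * a 5,
    8 * √2 * √5 * a 5]

lemma sum_univ_fifteen (f : Fin 15 → ℝ) :
    ∑ i, f i = f 0 + f 1 + f 2 + f 3 + f 4 + f 5 + f 6 + f 7 + f 8 + f 9 + f 10 + f 11 + f 12
      + f 13 + f 14 := by
  simp only [Fin.sum_univ_castSucc (n := 14), Fin.sum_univ_castSucc (n := 13),
    Fin.sum_univ_castSucc (n := 12), Fin.sum_univ_castSucc (n := 11),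
    Fin.sum_univ_castSucc (n := 10), Fin.sum_univ_castSucc (n := 9), sum_univ_nine]
  rfl

lemma quarticForm_eq_sum (a : Fin 9 → ℝ) (v : Fin 3 → ℝ) :
    quarticForm a v = ∑ m, quarticCoeff a m * ∏ i, v i ^ quarticExponent m i := by
  simp only [sum_univ_fifteen, quarticCoeff, quarticExponent, Fin.prod_univ_three,
    Matrix.cons_val, quarticForm]
  ring

lemma sum_quarticExponent (m : Fin 15) : ∑ i, quarticExponent m i = 4 := by
  revert m; decide

lemma integral_quarticForm_sq_eq_sum (a : Fin 9 → ℝ) :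
    ∫ p : S2, quarticForm a p.1.ofLp ^ 2 ∂(volume : Measure E3).toSphere =
      64 / 945 * Real.pi * ∑ m, ∑ m', quarticCoeff a m * quarticCoeff a m'
        * ∏ i, gaussMoment (quarticExponent m i + quarticExponent m' i) := by
  have h (p : S2) : quarticForm a p.1.ofLp ^ 2 = ∑ m, ∑ m', quarticCoeff a m * quarticCoeff a m'
      * ∏ i, p.1 i ^ (quarticExponent m i + quarticExponent m' i) := by
    rw [sq, quarticForm_eq_sum, Finset.sum_mul_sum]
    simp only [pow_add, Finset.prod_mul_distrib]
    exact Finset.sum_congr rfl fun m _ => Finset.sum_congr rfl fun m' _ => by ring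
  have hint (m m' : Fin 15) : Integrable (fun p : S2 => quarticCoeff a m * quarticCoeff a m'
      * ∏ i, p.1 i ^ (quarticExponent m i + quarticExponent m' i))
      (volume : Measure E3).toSphere :=
    Continuous.integrable_of_hasCompactSupport (by fun_prop) (HasCompactSupport.of_compactSpace _)
  simp only [h]
  rw [integral_finsetSum _ fun m _ => integrable_finsetSum _ fun m' _ => hint m m',
    Finset.mul_sum]
  refine Finset.sum_congr rfl fun m _ => ?_
  rw [integral_finsetSum _ fun m' _ => hint m m', Finset.mul_sum]
  refine Finset.sum_congr rfl fun m' _ => ?_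
  rw [integral_const_mul, integral_sphere_monomial (fun i => _)
    (by rw [Finset.sum_add_distrib, sum_quarticExponent, sum_quarticExponent])]
  ring

set_option maxHeartbeats 1000000 in
lemma sum_quarticCoeff_gaussMoment (a : Fin 9 → ℝ) :
    ∑ m, ∑ m', quarticCoeff a m * quarticCoeff a m'
        * ∏ i, gaussMoment (quarticExponent m i + quarticExponent m' i) = 420 * (a ⬝ᵥ a) := by
  have g0 : gaussMoment 0 = 1 := rfl
  have g1 : gaussMoment 1 = 0 := rfl
  have g2 : gaussMoment 2 = 1 / 2 := by norm_num [gaussMoment]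
  have g3 : gaussMoment 3 = 0 := by norm_num [gaussMoment]
  have g4 : gaussMoment 4 = 3 / 4 := by norm_num [gaussMoment]
  have g5 : gaussMoment 5 = 0 := by norm_num [gaussMoment]
  have g6 : gaussMoment 6 = 15 / 8 := by norm_num [gaussMoment]
  have g7 : gaussMoment 7 = 0 := by norm_num [gaussMoment]
  have g8 : gaussMoment 8 = 105 / 16 := by norm_num [gaussMoment]
  simp only [sum_univ_fifteen, quarticExponent, Fin.prod_univ_three, Matrix.cons_val,
    Nat.reduceAdd, g0, g1, g2, g3, g4, g5, g6, g7, g8, mul_zero, zero_mul, add_zero, zero_add,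
    dotProduct, sum_univ_nine]
  simp only [quarticCoeff, Matrix.cons_val]
  ring_nf
  simp only [sq_sqrt_two, sq_sqrt_five, sq_sqrt_seven]
  ring

/-- The basis `Y₄,₋₄, …, Y₄,₄` is orthonormal. -/
lemma integral_harmonic_sq (a : Fin 9 → ℝ) :
    ∫ p, harmonic a p ^ 2 ∂(volume : Measure E3).toSphere = a ⬝ᵥ a := by
  have hp : √Real.pi ≠ 0 := (Real.sqrt_pos.2 Real.pi_pos).ne'
  have hq : √Real.pi ^ 2 = Real.pi := Real.sq_sqrt Real.pi_pos.le
  simp only [harmonic_eq, mul_pow]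
  rw [integral_const_mul, integral_quarticForm_sq_eq_sum, sum_quarticCoeff_gaussMoment]
  field_simp
  rw [hq]
  ring

lemma isNormalized_iff (a : Fin 9 → ℝ) : IsNormalized (harmonic a) ↔ a ⬝ᵥ a = 1 := by
  rw [IsNormalized, integral_harmonic_sq]

lemma harmonic_sub (a b : Fin 9 → ℝ) (p : S2) :
    harmonic (a - b) p = harmonic a p - harmonic b p := by
  simp only [harmonic, Pi.sub_apply, sub_mul, Finset.sum_sub_distrib]

lemma eq_of_quarticForm_eq {a b : Fin 9 → ℝ}
    (h : ∀ v, quarticForm a v = quarticForm b v) : a = b := by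
  have h0 := integral_harmonic_sq (a - b)
  have hz (p : S2) : harmonic (a - b) p = 0 := by
    rw [harmonic_sub, harmonic_eq, harmonic_eq, h, sub_self]
  simp only [hz] at h0
  rw [← sub_eq_zero, ← dotProduct_self_eq_zero, ← h0]
  simp

lemma mem_specialOrthogonalGroup_iff_mul_transpose {Q : Matrix (Fin 3) (Fin 3) ℝ} :
    Q ∈ specialOrthogonalGroup (Fin 3) ℝ ↔ Q * Qᵀ = 1 ∧ Q.det = 1 := by
  rw [mem_specialOrthogonalGroup_iff, mem_orthogonalGroup_iff]

lemma transpose_mem_specialOrthogonalGroup {Q : Matrix (Fin 3) (Fin 3) ℝ}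
    (hQ : Q ∈ specialOrthogonalGroup (Fin 3) ℝ) : Qᵀ ∈ specialOrthogonalGroup (Fin 3) ℝ := by
  rw [mem_specialOrthogonalGroup_iff_mul_transpose] at *
  rw [transpose_transpose, det_transpose]
  exact ⟨mul_eq_one_comm.1 hQ.1, hQ.2⟩

lemma mul_transpose_of_mem {Q : Matrix (Fin 3) (Fin 3) ℝ}
    (hQ : Q ∈ specialOrthogonalGroup (Fin 3) ℝ) : Q * Qᵀ = 1 :=
  (mem_specialOrthogonalGroup_iff_mul_transpose.1 hQ).1

lemma transpose_mul_of_mem {Q : Matrix (Fin 3) (Fin 3) ℝ}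
    (hQ : Q ∈ specialOrthogonalGroup (Fin 3) ℝ) : Qᵀ * Q = 1 :=
  mul_eq_one_comm.1 (mul_transpose_of_mem hQ)

lemma rotZ_mem (γ : ℝ) : rotZ γ ∈ specialOrthogonalGroup (Fin 3) ℝ := by
  have h := Real.cos_sq_add_sin_sq γ
  rw [mem_specialOrthogonalGroup_iff_mul_transpose]
  constructor
  · ext i j
    fin_cases i <;> fin_cases j <;> simp [rotZ, Matrix.mul_apply, Fin.sum_univ_three] <;> grind
  · simp [rotZ, det_fin_three]
    linarith

lemma rotXHalfPi_mem : rotXHalfPi ∈ specialOrthogonalGroup (Fin 3) ℝ := by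
  rw [mem_specialOrthogonalGroup_iff_mul_transpose]
  constructor
  · ext i j
    fin_cases i <;> fin_cases j <;> simp [rotXHalfPi, Matrix.mul_apply, Fin.sum_univ_three]
  · simp [rotXHalfPi, det_fin_three]

/-- The rotation of `ℝ³` about the `y`-axis corresponding to `Ry`. -/
def rotY (β : ℝ) : Matrix (Fin 3) (Fin 3) ℝ := rotXHalfPi * rotZ β * rotXHalfPiᵀ

/-- The rotation of `ℝ³` about the `x`-axis corresponding to `Rx`. -/
def rotX (α : ℝ) : Matrix (Fin 3) (Fin 3) ℝ :=
  (rotY (Real.pi / 2))ᵀ * rotZ α * rotY (Real.pi / 2)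

/-- The rotation `Q` of `ℝ³` acts on coordinate vectors of harmonics of degree 4 by the orthogonal
matrix `M`. -/
structure ActsBy (Q : Matrix (Fin 3) (Fin 3) ℝ) (M : Matrix (Fin 9) (Fin 9) ℝ) : Prop where
  mem : Q ∈ specialOrthogonalGroup (Fin 3) ℝ
  mul_transpose : M * Mᵀ = 1
  quarticForm_eq (a : Fin 9 → ℝ) (v : Fin 3 → ℝ) :
    quarticForm (M *ᵥ a) (Q *ᵥ v) = quarticForm a v
  isotropic_iff (a : Fin 9 → ℝ) : Isotropic (M *ᵥ a) ↔ Isotropic a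

namespace ActsBy

variable {Q Q' : Matrix (Fin 3) (Fin 3) ℝ} {M M' : Matrix (Fin 9) (Fin 9) ℝ}

lemma mul (h : ActsBy Q M) (h' : ActsBy Q' M') : ActsBy (Q * Q') (M * M') where
  mem := mul_mem h.mem h'.mem
  mul_transpose := by
    rw [transpose_mul, Matrix.mul_assoc, ← Matrix.mul_assoc M', h'.mul_transpose, Matrix.one_mul,
      h.mul_transpose]
  quarticForm_eq a v := by
    rw [← mulVec_mulVec, ← mulVec_mulVec, h.quarticForm_eq, h'.quarticForm_eq]
  isotropic_iff a := by rw [← mulVec_mulVec, h.isotropic_iff, h'.isotropic_iff]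

lemma transpose (h : ActsBy Q M) : ActsBy Qᵀ Mᵀ where
  mem := transpose_mem_specialOrthogonalGroup h.mem
  mul_transpose := by rw [transpose_transpose]; exact mul_eq_one_comm.1 h.mul_transpose
  quarticForm_eq a v := by
    rw [← h.quarticForm_eq, mulVec_mulVec, mulVec_mulVec, h.mul_transpose,
      mul_transpose_of_mem h.mem, one_mulVec, one_mulVec]
  isotropic_iff a := by
    rw [← h.isotropic_iff, mulVec_mulVec, h.mul_transpose, one_mulVec]

lemma dotProduct_mulVec (h : ActsBy Q M) (a : Fin 9 → ℝ) :
    (M *ᵥ a) ⬝ᵥ (M *ᵥ a) = a ⬝ᵥ a := by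
  rw [Matrix.dotProduct_mulVec, ← mulVec_transpose, mulVec_mulVec,
    mul_eq_one_comm.1 h.mul_transpose, one_mulVec]

/-- The action of a rotation on coordinate vectors is unique. -/
lemma mulVec_eq (h : ActsBy Q M) {a b : Fin 9 → ℝ}
    (hab : ∀ v, quarticForm b (Q *ᵥ v) = quarticForm a v) : M *ᵥ a = b := by
  refine eq_of_quarticForm_eq fun v => ?_
  have hv : v = Q *ᵥ (Qᵀ *ᵥ v) := by
    rw [mulVec_mulVec, mul_transpose_of_mem h.mem, one_mulVec]
  rw [hv, h.quarticForm_eq, hab]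

end ActsBy

lemma actsBy_rotZ (γ : ℝ) : ActsBy (rotZ γ) (Rz γ) :=
  ⟨rotZ_mem γ, Rz_mul_transpose γ, quarticForm_Rz γ, isotropic_Rz_iff γ⟩

lemma actsBy_rotXHalfPi : ActsBy rotXHalfPi RxHalfPi :=
  ⟨rotXHalfPi_mem, RxHalfPi_mul_transpose, quarticForm_RxHalfPi, isotropic_RxHalfPi_iff⟩

lemma actsBy_rotY (β : ℝ) : ActsBy (rotY β) (Ry β) :=
  (actsBy_rotXHalfPi.mul (actsBy_rotZ β)).mul actsBy_rotXHalfPi.transpose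

lemma actsBy_rotX (α : ℝ) : ActsBy (rotX α) (Rx α) :=
  ((actsBy_rotY _).transpose.mul (actsBy_rotZ α)).mul (actsBy_rotY _)

lemma actsBy_euler (α β γ : ℝ) : ActsBy (rotX α * rotY β * rotZ γ) (Rx α * Ry β * Rz γ) :=
  ((actsBy_rotX α).mul (actsBy_rotY β)).mul (actsBy_rotZ γ)

lemma exists_polar (x y : ℝ) : ∃ θ : ℝ,
    x = √(x ^ 2 + y ^ 2) * Real.cos θ ∧ y = √(x ^ 2 + y ^ 2) * Real.sin θ := by
  refine ⟨Complex.arg ⟨x, y⟩, ?_, ?_⟩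
  · have h := Complex.norm_mul_cos_arg ⟨x, y⟩
    rw [Complex.norm_eq_sqrt_sq_add_sq] at h
    exact h.symm
  · have h := Complex.norm_mul_sin_arg ⟨x, y⟩
    rw [Complex.norm_eq_sqrt_sq_add_sq] at h
    exact h.symm

lemma rotY_eq (β : ℝ) :
    rotY β = !![Real.cos β, 0, -Real.sin β; 0, 1, 0; Real.sin β, 0, Real.cos β] := by
  ext i j
  fin_cases i <;> fin_cases j <;>
    simp [rotY, rotXHalfPi, rotZ, Matrix.mul_apply, Fin.sum_univ_three]

lemma rotX_eq (α : ℝ) :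
    rotX α = !![1, 0, 0; 0, Real.cos α, -Real.sin α; 0, Real.sin α, Real.cos α] := by
  rw [rotX, rotY_eq]
  ext i j
  fin_cases i <;> fin_cases j <;>
    simp [rotZ, Matrix.mul_apply, Fin.sum_univ_three]

lemma exists_rotX_rotY_mulVec {v : Fin 3 → ℝ} (hv : v 0 ^ 2 + v 1 ^ 2 + v 2 ^ 2 = 1) :
    ∃ α β : ℝ, (rotX α * rotY β) *ᵥ ![0, 0, 1] = v := by
  obtain ⟨α, h2, h1⟩ := exists_polar (v 2) (-v 1)
  obtain ⟨β, hr, h0⟩ := exists_polar (√(v 2 ^ 2 + (-v 1) ^ 2)) (-v 0)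
  have h : √(v 2 ^ 2 + (-v 1) ^ 2) ^ 2 + (-v 0) ^ 2 = 1 := by
    rw [Real.sq_sqrt (by positivity)]; linarith
  rw [h, Real.sqrt_one, one_mul] at hr h0
  refine ⟨α, β, ?_⟩
  rw [← mulVec_mulVec, mulVec_three, mulVec_three, rotX_eq, rotY_eq]
  ext i
  fin_cases i
  · simp; linarith
  · simp; rw [← hr]; linarith
  · simp; rw [← hr]; linarith

lemma exists_eq_rotZ {Q : Matrix (Fin 3) (Fin 3) ℝ} (hQ : Q ∈ specialOrthogonalGroup (Fin 3) ℝ)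
    (h : Q *ᵥ ![0, 0, 1] = ![0, 0, 1]) : ∃ γ, Q = rotZ γ := by
  have hr := mul_transpose_of_mem hQ
  have hc := transpose_mul_of_mem hQ
  have hd := (mem_specialOrthogonalGroup_iff.1 hQ).2
  rw [mulVec_three] at h
  have h02 : Q 0 2 = 0 := by simpa using congrFun h 0
  have h12 : Q 1 2 = 0 := by simpa using congrFun h 1
  have h22 : Q 2 2 = 1 := by simpa using congrFun h 2
  have r2 := congrFun (congrFun hr 2) 2
  have c0 := congrFun (congrFun hc 0) 0
  have c01 := congrFun (congrFun hc 0) 1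
  simp [Matrix.mul_apply, Fin.sum_univ_three, h22] at r2 c0 c01
  have h20 : Q 2 0 = 0 := by nlinarith
  have h21 : Q 2 1 = 0 := by nlinarith
  rw [det_fin_three, h02, h12, h22, h20, h21] at hd
  rw [h20] at c0 c01
  rw [h21] at c01
  obtain ⟨γ, hx, hy⟩ := exists_polar (Q 0 0) (Q 1 0)
  have hs : Q 0 0 ^ 2 + Q 1 0 ^ 2 = 1 := by linarith
  rw [hs, Real.sqrt_one, one_mul] at hx hy
  have h11 : Q 1 1 = Q 0 0 := by linear_combination Q 0 0 * hd + Q 1 0 * c01 - Q 1 1 * hs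
  have h01 : Q 0 1 = -Q 1 0 := by linear_combination Q 0 0 * c01 - Q 1 0 * hd - Q 0 1 * hs
  refine ⟨γ, ?_⟩
  ext i j
  fin_cases i <;> fin_cases j <;> simp [rotZ, ← hx, ← hy, h02, h12, h22, h20, h21, h11, h01]

/-- Every rotation is a product of rotations about the coordinate axes. -/
lemma exists_euler_angles {P : Matrix (Fin 3) (Fin 3) ℝ}
    (hP : P ∈ specialOrthogonalGroup (Fin 3) ℝ) :
    ∃ α β γ : ℝ, P = rotX α * rotY β * rotZ γ := by
  have hc := congrFun (congrFun (transpose_mul_of_mem hP) 2) 2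
  simp only [Matrix.mul_apply, Fin.sum_univ_three, transpose_apply, one_apply_eq] at hc
  obtain ⟨α, β, h⟩ := exists_rotX_rotY_mulVec (v := P *ᵥ ![0, 0, 1]) (by
    rw [mulVec_three]; simp; linarith)
  have hR := ((actsBy_rotX α).mul (actsBy_rotY β)).mem
  obtain ⟨γ, hγ⟩ := exists_eq_rotZ (mul_mem (transpose_mem_specialOrthogonalGroup hR) hP) (by
    rw [← mulVec_mulVec, ← h, mulVec_mulVec, transpose_mul_of_mem hR, one_mulVec])
  exact ⟨α, β, γ, by
    rw [← hγ, ← Matrix.mul_assoc, mul_transpose_of_mem hR, Matrix.one_mul]⟩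

lemma exists_actsBy_euler {P : Matrix (Fin 3) (Fin 3) ℝ}
    (hP : P ∈ specialOrthogonalGroup (Fin 3) ℝ) :
    ∃ α β γ : ℝ, ActsBy P (Rx α * Ry β * Rz γ) := by
  obtain ⟨α, β, γ, rfl⟩ := exists_euler_angles hP
  exact ⟨α, β, γ, actsBy_euler α β γ⟩

lemma quarticForm_smul (a : Fin 9 → ℝ) (r : ℝ) (v : Fin 3 → ℝ) :
    quarticForm a (r • v) = r ^ 4 * quarticForm a v := by
  simp only [quarticForm, Pi.smul_apply, smul_eq_mul]
  ring

lemma quarticForm_neg (a : Fin 9 → ℝ) (v : Fin 3 → ℝ) :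
    quarticForm (-a) v = -quarticForm a v := by
  simp only [quarticForm, Pi.neg_apply]
  ring

lemma dotProduct_mulVec_of_mem {Q : Matrix (Fin 3) (Fin 3) ℝ}
    (hQ : Q ∈ specialOrthogonalGroup (Fin 3) ℝ) (v w : Fin 3 → ℝ) :
    (Q *ᵥ v) ⬝ᵥ (Q *ᵥ w) = v ⬝ᵥ w := by
  rw [Matrix.dotProduct_mulVec, ← mulVec_transpose, mulVec_mulVec, transpose_mul_of_mem hQ,
    one_mulVec]

lemma exists_smul_unit (v : Fin 3 → ℝ) (hv : v ≠ 0) :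
    ∃ (r : ℝ) (u : Fin 3 → ℝ), u ⬝ᵥ u = 1 ∧ v = r • u := by
  have h : 0 < v ⬝ᵥ v := by
    rw [← star_trivial v]; exact dotProduct_star_self_pos_iff.2 hv
  refine ⟨√(v ⬝ᵥ v), (√(v ⬝ᵥ v))⁻¹ • v, ?_, ?_⟩
  · rw [smul_dotProduct, dotProduct_smul, smul_eq_mul, smul_eq_mul, ← mul_assoc, ← mul_inv,
      Real.mul_self_sqrt h.le, inv_mul_cancel₀ h.ne']
  · rw [smul_smul, mul_inv_cancel₀ (Real.sqrt_pos.2 h).ne', one_smul]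

/-- The point of the unit sphere with given coordinates. -/
def spherePoint (u : Fin 3 → ℝ) (hu : u ⬝ᵥ u = 1) : S2 :=
  ⟨WithLp.toLp 2 u, by
    rw [mem_sphere_zero_iff_norm, EuclideanSpace.norm_eq, Real.sqrt_eq_one]
    simpa [dotProduct, sq] using hu⟩

lemma dotProduct_self_of_sphere (p : S2) : p.1.ofLp ⬝ᵥ p.1.ofLp = 1 := by
  have h := mem_sphere_zero_iff_norm.1 p.2
  rw [EuclideanSpace.norm_eq, Real.sqrt_eq_one] at h
  simpa [dotProduct, sq] using h

lemma harmonic_eq_iff (a b : Fin 9 → ℝ) (p q : S2) : harmonic a p = harmonic b q ↔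
    quarticForm a p.1.ofLp = quarticForm b q.1.ofLp := by
  rw [harmonic_eq, harmonic_eq]
  exact mul_right_inj' (div_pos three_pos
    (mul_pos (by norm_num) (Real.sqrt_pos.2 Real.pi_pos))).ne'

lemma hasOctahedralSymmetry_iff (a : Fin 9 → ℝ) : HasOctahedralSymmetry (harmonic a) ↔
    ∃ P ∈ specialOrthogonalGroup (Fin 3) ℝ, ∀ Q ∈ octahedralRotations, ∀ v,
      quarticForm a ((P * Q * Pᵀ) *ᵥ v) = quarticForm a v := by
  refine exists_congr fun P => and_congr_right fun hP => forall₂_congr fun Q hQ => ?_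
  constructor
  · intro h v
    rcases eq_or_ne v 0 with rfl | hv
    · rw [mulVec_zero]
    · obtain ⟨r, u, hu, rfl⟩ := exists_smul_unit v hv
      have hR := mul_mem (mul_mem hP hQ.1) (transpose_mem_specialOrthogonalGroup hP)
      have h1 := h (spherePoint u hu) (spherePoint ((P * Q * Pᵀ) *ᵥ u)
        ((dotProduct_mulVec_of_mem hR u u).trans hu)) rfl
      rw [harmonic_eq_iff] at h1
      rw [mulVec_smul, quarticForm_smul, quarticForm_smul]
      exact congrArg _ h1
  · intro h p q hpq
    rw [harmonic_eq_iff, hpq, h]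

lemma mem_octahedralRotations {Q : Matrix (Fin 3) (Fin 3) ℝ}
    (hQ : Q ∈ specialOrthogonalGroup (Fin 3) ℝ)
    (h : ∀ v ∈ octahedronVertices, Q *ᵥ v ∈ octahedronVertices)
    (h' : ∀ v ∈ octahedronVertices, Qᵀ *ᵥ v ∈ octahedronVertices) :
    Q ∈ octahedralRotations := by
  refine ⟨hQ, Set.Subset.antisymm (Set.image_subset_iff.2 h) fun v hv => ⟨_, h' v hv, ?_⟩⟩
  simp only [mulVec_mulVec, mul_transpose_of_mem hQ, one_mulVec]

lemma rotZ_half_pi_mem : rotZ (Real.pi / 2) ∈ octahedralRotations := by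
  refine mem_octahedralRotations (rotZ_mem _) ?_ ?_ <;>
  · rintro v ⟨i, rfl | rfl⟩ <;>
    · simp only [octahedronVertices, Set.mem_ofPred_eq, Fin.exists_fin_succ, funext_iff,
        Fin.forall_fin_succ]
      fin_cases i <;> simp [rotZ]

lemma rotXHalfPi_mem_octahedralRotations : rotXHalfPi ∈ octahedralRotations := by
  refine mem_octahedralRotations rotXHalfPi_mem ?_ ?_ <;>
  · rintro v ⟨i, rfl | rfl⟩ <;>
    · simp only [octahedronVertices, Set.mem_ofPred_eq, Fin.exists_fin_succ, funext_iff,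
        Fin.forall_fin_succ]
      fin_cases i <;> simp [rotXHalfPi]

lemma sqrt_seven_div_twelve : √(7 / 12 : ℝ) = √7 / √12 := Real.sqrt_div (by norm_num) _
lemma sqrt_five_div_twelve : √(5 / 12 : ℝ) = √5 / √12 := Real.sqrt_div (by norm_num) _

lemma sq_sqrt_seven_div_twelve : √(7 / 12 : ℝ) ^ 2 = 7 / 12 := Real.sq_sqrt (by norm_num)
lemma sq_sqrt_five_div_twelve : √(5 / 12 : ℝ) ^ 2 = 5 / 12 := Real.sq_sqrt (by norm_num)

lemma quarticForm_refVec (v : Fin 3 → ℝ) : quarticForm refVec v =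
    √(7 / 12) * (20 * (v 0 ^ 4 + v 1 ^ 4 + v 2 ^ 4) - 12 * (v ⬝ᵥ v) ^ 2) := by
  simp only [quarticForm, refVec, Matrix.cons_val, dotProduct, Fin.sum_univ_three,
    sqrt_seven_div_twelve, sqrt_five_div_twelve]
  linear_combination √7 / √12 * (v 0 ^ 4 - 6 * v 0 ^ 2 * v 1 ^ 2 + v 1 ^ 4) * sq_sqrt_five

lemma finsum_octahedronVertices (v : Fin 3 → ℝ) :
    ∑ᶠ w ∈ octahedronVertices, (w ⬝ᵥ v) ^ 4 = 2 * (v 0 ^ 4 + v 1 ^ 4 + v 2 ^ 4) := by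
  have h : octahedronVertices =
      Set.range (fun q : Fin 3 × Bool => (Pi.single q.1 (if q.2 then 1 else -1) : Fin 3 → ℝ)) := by
    ext w
    constructor
    · rintro ⟨i, rfl | rfl⟩
      exacts [⟨(i, true), by simp⟩, ⟨(i, false), by simp⟩]
    · rintro ⟨⟨i, b⟩, rfl⟩
      cases b
      exacts [⟨i, Or.inr (by simp)⟩, ⟨i, Or.inl (by simp)⟩]
  have hinj : Function.Injective
      (fun q : Fin 3 × Bool => (Pi.single q.1 (if q.2 then 1 else -1) : Fin 3 → ℝ)) := by
    rintro ⟨i, b⟩ ⟨j, c⟩ hq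
    have hi := congrFun hq i
    have hij : i = j := by
      by_contra hne
      cases b <;> simp [Pi.single_eq_of_ne hne] at hi
    subst hij
    cases b <;> cases c <;> simp at hi ⊢ <;> linarith
  rw [h, finsum_mem_range hinj, finsum_eq_sum_of_fintype, Fintype.sum_prod_type]
  simp [Fin.sum_univ_three]
  ring

lemma quarticForm_refVec_mulVec {Q : Matrix (Fin 3) (Fin 3) ℝ} (hQ : Q ∈ octahedralRotations)
    (v : Fin 3 → ℝ) : quarticForm refVec (Q *ᵥ v) = quarticForm refVec v := by
  have hinj : Function.Injective fun w : Fin 3 → ℝ => Q *ᵥ w := fun w w' hw => by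
    simpa [mulVec_mulVec, transpose_mul_of_mem hQ.1] using congrArg (Qᵀ *ᵥ ·) hw
  have h := finsum_octahedronVertices (Q *ᵥ v)
  rw [← hQ.2, finsum_mem_image hinj.injOn] at h
  simp only [dotProduct_mulVec_of_mem hQ.1, finsum_octahedronVertices] at h
  rw [quarticForm_refVec, quarticForm_refVec, dotProduct_mulVec_of_mem hQ.1]
  linear_combination (-10 * √(7 / 12)) * h

lemma refVec_dotProduct : refVec ⬝ᵥ refVec = 1 := by
  simp only [dotProduct, sum_univ_nine, refVec, Matrix.cons_val]
  linear_combination sq_sqrt_seven_div_twelve + sq_sqrt_five_div_twelve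

lemma isotropic_refVec : Isotropic refVec := by
  rw [isotropic_iff]
  simp only [refVec, Matrix.cons_val]
  refine ⟨?_, by ring, by ring, by ring, by ring⟩
  linear_combination 28 * sq_sqrt_five_div_twelve - 20 * sq_sqrt_seven_div_twelve

lemma isotropic_neg {a : Fin 9 → ℝ} (ha : Isotropic a) : Isotropic (-a) := fun k => by
  rw [mulVec_neg, neg_dotProduct_neg, ha k]

lemma hasOctahedralSymmetry_mulVec {P : Matrix (Fin 3) (Fin 3) ℝ} {M : Matrix (Fin 9) (Fin 9) ℝ}
    (h : ActsBy P M) {c : Fin 9 → ℝ}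
    (hc : ∀ Q ∈ octahedralRotations, ∀ v, quarticForm c (Q *ᵥ v) = quarticForm c v) :
    HasOctahedralSymmetry (harmonic (M *ᵥ c)) := by
  refine (hasOctahedralSymmetry_iff _).2 ⟨P, h.mem, fun Q hQ v => ?_⟩
  rw [← mulVec_mulVec, ← mulVec_mulVec, h.quarticForm_eq, hc Q hQ, ← h.quarticForm_eq,
    mulVec_mulVec, mul_transpose_of_mem h.mem, one_mulVec]

lemma eq_refVec_or_neg {c : Fin 9 → ℝ} (hn : c ⬝ᵥ c = 1)
    (hc : ∀ Q ∈ octahedralRotations, ∀ v, quarticForm c (Q *ᵥ v) = quarticForm c v) :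
    c = refVec ∨ c = -refVec := by
  have hz := (actsBy_rotZ (Real.pi / 2)).mulVec_eq (hc _ rotZ_half_pi_mem)
  have hx := actsBy_rotXHalfPi.mulVec_eq (hc _ rotXHalfPi_mem_octahedralRotations)
  have cos3 : Real.cos (3 * (Real.pi / 2)) = 0 := by
    rw [show 3 * (Real.pi / 2) = Real.pi / 2 + Real.pi by ring, Real.cos_add_pi, Real.cos_pi_div_two,
      neg_zero]
  have sin3 : Real.sin (3 * (Real.pi / 2)) = -1 := by
    rw [show 3 * (Real.pi / 2) = Real.pi / 2 + Real.pi by ring, Real.sin_add_pi, Real.sin_pi_div_two]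
  have two : 2 * (Real.pi / 2) = Real.pi := by ring
  rw [Rz_mulVec, cos3, sin3, two] at hz
  rw [RxHalfPi_mulVec] at hx
  have z1 := congrFun hz 1
  have z2 := congrFun hz 2
  have z3 := congrFun hz 3
  have z5 := congrFun hz 5
  have z6 := congrFun hz 6
  have z7 := congrFun hz 7
  have x0 := congrFun hx 0
  have x4 := congrFun hx 4
  simp at z1 z2 z3 z5 z6 z7 x0 x4
  have h1 : c 1 = 0 := by linarith
  have h2 : c 2 = 0 := by linarith
  have h3 : c 3 = 0 := by linarith
  have h5 : c 5 = 0 := by linarith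
  have h6 : c 6 = 0 := by linarith
  have h7 : c 7 = 0 := by linarith
  have h0 : c 0 = 0 := by rw [← x0, h5, h7]; ring
  have h48 : √5 * c 4 = √7 * c 8 := by
    have h5' : √(5 : ℝ) ≠ 0 := by positivity
    apply mul_left_cancel₀ h5'
    rw [h6] at x4
    linear_combination c 4 * sq_sqrt_five - 8 * x4
  simp only [dotProduct, sum_univ_nine, h0, h1, h2, h3, h5, h6, h7] at hn
  have h8 : c 8 ^ 2 = 5 / 12 := by
    have e : (√5 * c 4) ^ 2 = (√7 * c 8) ^ 2 := by rw [h48]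
    rw [mul_pow, mul_pow, sq_sqrt_five, sq_sqrt_seven] at e
    linarith
  have s5' : √(5 : ℝ) ≠ 0 := by positivity
  rw [← sq_sqrt_five_div_twelve, sq_eq_sq_iff_eq_or_eq_neg] at h8
  refine h8.imp (fun h8 => ?_) fun h8 => ?_
  · have h4 : c 4 = √(7 / 12) := by
      apply mul_left_cancel₀ s5'
      rw [h48, h8, sqrt_seven_div_twelve, sqrt_five_div_twelve]
      ring
    ext i
    fin_cases i <;> simp [refVec, *]
  · have h4 : c 4 = -√(7 / 12) := by
      apply mul_left_cancel₀ s5'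
      rw [h48, h8, sqrt_seven_div_twelve, sqrt_five_div_twelve]
      ring
    ext i
    fin_cases i <;> simp [refVec, *]

/-- The coordinate vectors of the rotations of `± refVec`. -/
def OnOrbit (a : Fin 9 → ℝ) : Prop := ∃ α β γ : ℝ,
  a = (Rx α * Ry β * Rz γ) *ᵥ refVec ∨ a = -((Rx α * Ry β * Rz γ) *ᵥ refVec)

lemma onOrbit_of_actsBy {P : Matrix (Fin 3) (Fin 3) ℝ} {M : Matrix (Fin 9) (Fin 9) ℝ}
    (h : ActsBy P M) {c : Fin 9 → ℝ} (hc : c = refVec ∨ c = -refVec) : OnOrbit (M *ᵥ c) := by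
  obtain ⟨α, β, γ, h'⟩ := exists_actsBy_euler h.mem
  have e : M *ᵥ refVec = (Rx α * Ry β * Rz γ) *ᵥ refVec := h.mulVec_eq (h'.quarticForm_eq refVec)
  refine ⟨α, β, γ, ?_⟩
  rcases hc with rfl | rfl
  · exact Or.inl e
  · exact Or.inr (by rw [mulVec_neg, e])

lemma OnOrbit.exists_actsBy {a : Fin 9 → ℝ} (ha : OnOrbit a) :
    ∃ P M c, ActsBy P M ∧ (c = refVec ∨ c = -refVec) ∧ a = M *ᵥ c := by
  obtain ⟨α, β, γ, h⟩ := ha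
  rcases h with h | h
  · exact ⟨_, _, _, actsBy_euler α β γ, Or.inl rfl, h⟩
  · exact ⟨_, _, _, actsBy_euler α β γ, Or.inr rfl, by rw [h, mulVec_neg]⟩

lemma OnOrbit.isotropic {a : Fin 9 → ℝ} (ha : OnOrbit a) : a ⬝ᵥ a = 1 ∧ Isotropic a := by
  obtain ⟨P, M, c, h, hc, rfl⟩ := ha.exists_actsBy
  rw [h.dotProduct_mulVec, h.isotropic_iff]
  rcases hc with rfl | rfl
  · exact ⟨refVec_dotProduct, isotropic_refVec⟩
  · exact ⟨by rw [neg_dotProduct_neg, refVec_dotProduct], isotropic_neg isotropic_refVec⟩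

lemma OnOrbit.hasOctahedralSymmetry {a : Fin 9 → ℝ} (ha : OnOrbit a) :
    HasOctahedralSymmetry (harmonic a) := by
  obtain ⟨P, M, c, h, hc, rfl⟩ := ha.exists_actsBy
  refine hasOctahedralSymmetry_mulVec h fun Q hQ v => ?_
  rcases hc with rfl | rfl
  · exact quarticForm_refVec_mulVec hQ v
  · rw [quarticForm_neg, quarticForm_neg, quarticForm_refVec_mulVec hQ]

lemma onOrbit_of_hasOctahedralSymmetry {a : Fin 9 → ℝ} (hn : a ⬝ᵥ a = 1)
    (ha : HasOctahedralSymmetry (harmonic a)) : OnOrbit a := by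
  obtain ⟨P, hP, h⟩ := (hasOctahedralSymmetry_iff a).1 ha
  obtain ⟨α, β, γ, hE⟩ := exists_actsBy_euler hP
  set M := Rx α * Ry β * Rz γ
  have hc : Mᵀ *ᵥ a = refVec ∨ Mᵀ *ᵥ a = -refVec := by
    refine eq_refVec_or_neg (by rw [hE.transpose.dotProduct_mulVec, hn]) fun Q hQ v => ?_
    have e (w : Fin 3 → ℝ) : quarticForm (Mᵀ *ᵥ a) w = quarticForm a (P *ᵥ w) := by
      rw [← hE.transpose.quarticForm_eq a, mulVec_mulVec, transpose_mul_of_mem hP, one_mulVec]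
    rw [e, e, ← h Q hQ (P *ᵥ v), mulVec_mulVec, mulVec_mulVec, Matrix.mul_assoc _ Pᵀ,
      transpose_mul_of_mem hP, Matrix.mul_one]
  have h1 := onOrbit_of_actsBy hE hc
  rwa [mulVec_mulVec, hE.mul_transpose, one_mulVec] at h1

/-- The square of the harmonic with coordinate vector `c` is maximal at the north pole. -/
def MaximalAtPole (c : Fin 9 → ℝ) : Prop :=
  ∀ v, quarticForm c v ^ 2 ≤ (8 * c 4) ^ 2 * (v ⬝ᵥ v) ^ 4

lemma quarticForm_pole (c : Fin 9 → ℝ) : quarticForm c ![0, 0, 1] = 8 * c 4 := by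
  simp [quarticForm]
  ring

lemma MaximalAtPole.Rz {c : Fin 9 → ℝ} (hc : MaximalAtPole c) (γ : ℝ) :
    MaximalAtPole (Rz γ *ᵥ c) := fun v => by
  have h4 : (OctahedralHarmonics.Rz γ *ᵥ c) 4 = c 4 := by rw [Rz_mulVec]; rfl
  have hm := (actsBy_rotZ γ).transpose.mem
  rw [h4, ← (actsBy_rotZ γ).transpose.quarticForm_eq, mulVec_mulVec,
    mul_eq_one_comm.1 (actsBy_rotZ γ).mul_transpose, one_mulVec, ← dotProduct_mulVec_of_mem hm]
  exact hc _

lemma exists_maximalAtPole (a : Fin 9 → ℝ) :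
    ∃ Q M, ActsBy Q M ∧ MaximalAtPole (M *ᵥ a) := by
  have hcont : Continuous fun p : S2 => quarticForm a p.1.ofLp ^ 2 := by
    unfold quarticForm
    fun_prop
  have hne : (Set.univ : Set S2).Nonempty :=
    ⟨spherePoint ![0, 0, 1] (by simp [dotProduct, Fin.sum_univ_three]), trivial⟩
  obtain ⟨p, -, hp⟩ := isCompact_univ.exists_isMaxOn hne hcont.continuousOn
  have hp1 := dotProduct_self_of_sphere p
  simp only [dotProduct, Fin.sum_univ_three, ← sq] at hp1
  obtain ⟨α, β, hR⟩ := exists_rotX_rotY_mulVec hp1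
  have h := (actsBy_rotX α).mul (actsBy_rotY β)
  refine ⟨_, _, h.transpose, fun v => ?_⟩
  have e (w : Fin 3 → ℝ) : quarticForm ((Rx α * Ry β)ᵀ *ᵥ a) w =
      quarticForm a ((rotX α * rotY β) *ᵥ w) := by
    rw [← h.transpose.quarticForm_eq a, mulVec_mulVec, transpose_mul_of_mem h.mem, one_mulVec]
  rw [← quarticForm_pole, e, e, hR]
  rcases eq_or_ne v 0 with rfl | hv
  · simp [quarticForm]
  · obtain ⟨r, u, hu, rfl⟩ := exists_smul_unit v hv
    have hu' : ((rotX α * rotY β) *ᵥ u) ⬝ᵥ ((rotX α * rotY β) *ᵥ u) = 1 :=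
      (dotProduct_mulVec_of_mem h.mem u u).trans hu
    have h1 := isMaxOn_iff.1 hp (spherePoint _ hu') (Set.mem_univ _)
    simp only [spherePoint] at h1
    rw [mulVec_smul, quarticForm_smul, smul_dotProduct, dotProduct_smul, hu]
    calc _ = (r ^ 4) ^ 2 * quarticForm a ((rotX α * rotY β) *ᵥ u) ^ 2 := by ring
      _ ≤ (r ^ 4) ^ 2 * quarticForm a p.1.ofLp ^ 2 := by gcongr
      _ = _ := by simp only [smul_eq_mul]; ring

lemma linear_coeff_eq_zero {b : ℝ} {R : ℝ → ℝ} (hR : Differentiable ℝ R)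
    (h : ∀ t, 0 ≤ b * t + t ^ 2 * R t) : b = 0 := by
  have hd : HasDerivAt (fun t => b * t + t ^ 2 * R t) b 0 := by
    have := ((hasDerivAt_id (0 : ℝ)).const_mul b).add
      ((hasDerivAt_pow 2 (0 : ℝ)).mul (hR 0).hasDerivAt)
    convert! this using 1
    simp
  refine IsLocalMin.hasDerivAt_eq_zero (Filter.Eventually.of_forall fun t => ?_) hd
  simpa using h t

lemma MaximalAtPole.critical {c : Fin 9 → ℝ} (hc : MaximalAtPole c) :
    c 4 * c 5 = 0 ∧ c 4 * c 3 = 0 := by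
  have h25 : √(2 : ℝ) * √5 ≠ 0 := by positivity
  constructor
  · have h : -128 * (√2 * √5) * (c 4 * c 5) = 0 := by
      let K : ℝ → ℝ := fun t => c 4 * (-24 + 3 * t ^ 2) - 6 * √2 * √5 * c 5 * t
        + 2 * √5 * c 6 * (6 - t ^ 2) + 2 * √2 * √5 * √7 * c 7 * t + √5 * √7 * c 8 * t ^ 2
      refine linear_coeff_eq_zero (R := fun t => 64 * c 4 ^ 2 * (4 + 6 * t ^ 2 + 4 * t ^ 4 + t ^ 6)
        - (8 * √2 * √5 * c 5) ^ 2 - 2 * K t * (8 * c 4 + 8 * √2 * √5 * c 5 * t)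
        - t ^ 2 * K t ^ 2) (by fun_prop) fun t => ?_
      have h := hc ![t, 0, 1]
      simp only [quarticForm, dotProduct, Fin.sum_univ_three, Matrix.cons_val] at h
      rw [← sub_nonneg] at h
      convert h using 1
      simp only [K]
      ring
    simpa [h25, mul_assoc] using h
  · have h : -128 * (√2 * √5) * (c 4 * c 3) = 0 := by
      let K : ℝ → ℝ := fun t => c 4 * (-24 + 3 * t ^ 2) - 6 * √2 * √5 * c 3 * t
        - 2 * √5 * c 6 * (6 - t ^ 2) - 2 * √2 * √5 * √7 * c 1 * t + √5 * √7 * c 8 * t ^ 2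
      refine linear_coeff_eq_zero (R := fun t => 64 * c 4 ^ 2 * (4 + 6 * t ^ 2 + 4 * t ^ 4 + t ^ 6)
        - (8 * √2 * √5 * c 3) ^ 2 - 2 * K t * (8 * c 4 + 8 * √2 * √5 * c 3 * t)
        - t ^ 2 * K t ^ 2) (by fun_prop) fun t => ?_
      have h := hc ![0, t, 1]
      simp only [quarticForm, dotProduct, Fin.sum_univ_three, Matrix.cons_val] at h
      rw [← sub_nonneg] at h
      convert h using 1
      simp only [K]
      ring
    simpa [h25, mul_assoc] using h

lemma MaximalAtPole.ne_zero {c : Fin 9 → ℝ} (hc : MaximalAtPole c) (hn : c ⬝ᵥ c = 1) :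
    c 4 ≠ 0 := fun h4 => by
  have h : c = 0 := eq_of_quarticForm_eq fun v => by
    have h := hc v
    rw [h4] at h
    have h' : quarticForm c v = 0 := by nlinarith
    rw [h']
    simp [quarticForm]
  simp [h] at hn

lemma exists_rotate_eq_zero (x y : ℝ) {k : ℝ} (hk : k ≠ 0) :
    ∃ γ, Real.cos (k * γ) * x + Real.sin (k * γ) * y = 0 := by
  obtain ⟨θ, h1, h2⟩ := exists_polar y (-x)
  refine ⟨θ / k, ?_⟩
  rw [mul_div_cancel₀ _ hk]
  linear_combination Real.sin θ * h1 - Real.cos θ * h2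

/-- The pole is not a twofold axis. -/
lemma MaximalAtPole.six_eq_zero {c : Fin 9 → ℝ} (hc : MaximalAtPole c) (hi : Isotropic c)
    (h4 : c 4 ≠ 0) (h3 : c 3 = 0) (h5 : c 5 = 0) (h2 : c 2 = 0) : c 6 = 0 := by
  by_contra h6
  obtain ⟨e1, e2, e3, e4, e5⟩ := (isotropic_iff c).1 hi
  simp only [h3, h5, h2] at e1 e2 e3 e4 e5
  have h7' : √(7 : ℝ) ≠ 0 := by positivity
  have c4 := sq_pos_of_ne_zero h4
  have h0 : c 0 = 0 := by
    have : √7 * c 6 * c 0 = 0 := by linarith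
    simpa [h7', h6] using this
  have h8 : √7 * c 8 = -3 * √5 * c 4 := by
    apply mul_left_cancel₀ h6
    linear_combination e4 / 4
  have h8sq : 7 * c 8 ^ 2 = 45 * c 4 ^ 2 := by
    linear_combination (√7 * c 8 - 3 * √5 * c 4) * h8 - c 8 ^ 2 * sq_sqrt_seven
      + 9 * c 4 ^ 2 * sq_sqrt_five
  rw [h0] at e1 e2 e3
  have f7 : c 7 * (14 * c 8 + 5 * √7 * c 6) = 0 := by linear_combination e2
  have f1 : c 1 * (-14 * c 8 + 5 * √7 * c 6) = 0 := by linear_combination e3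
  have key : c 1 = 0 ∧ c 7 = 0 := by
    by_contra hne
    have hsq : 196 * c 8 ^ 2 = 175 * c 6 ^ 2 := by
      rcases not_and_or.1 hne with h | h
      · have g := (mul_eq_zero.1 f1).resolve_left h
        linear_combination (-14 * c 8 - 5 * √7 * c 6) * g + 25 * c 6 ^ 2 * sq_sqrt_seven
      · have g := (mul_eq_zero.1 f7).resolve_left h
        linear_combination (14 * c 8 - 5 * √7 * c 6) * g + 25 * c 6 ^ 2 * sq_sqrt_seven
    nlinarith [sq_nonneg (c 1), sq_nonneg (c 7)]
  rw [key.1, key.2] at e1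
  have h6sq : c 6 ^ 2 = 20 * c 4 ^ 2 := by linarith
  have bx := hc ![1, 0, 0]
  have b_y := hc ![0, 1, 0]
  simp only [quarticForm, dotProduct, Fin.sum_univ_three, Matrix.cons_val] at bx b_y
  have h58 : √5 * √7 * c 8 = -15 * c 4 := by
    linear_combination √5 * h8 - 3 * c 4 * sq_sqrt_five
  have hx' : (-12 * c 4 - 2 * √5 * c 6) ^ 2 ≤ 64 * c 4 ^ 2 := by
    have e : -12 * c 4 - 2 * √5 * c 6 = 3 * c 4 - 2 * √5 * c 6 + √5 * √7 * c 8 := by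
      rw [h58]; ring
    rw [e]
    convert bx using 1 <;> ring
  have hy' : (-12 * c 4 + 2 * √5 * c 6) ^ 2 ≤ 64 * c 4 ^ 2 := by
    have e : -12 * c 4 + 2 * √5 * c 6 = 3 * c 4 + 2 * √5 * c 6 + √5 * √7 * c 8 := by
      rw [h58]; ring
    rw [e]
    convert b_y using 1 <;> ring
  have hsum : (-12 * c 4 - 2 * √5 * c 6) ^ 2 + (-12 * c 4 + 2 * √5 * c 6) ^ 2 =
      1088 * c 4 ^ 2 := by
    linear_combination 8 * c 6 ^ 2 * sq_sqrt_five + 40 * h6sq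
  linarith

/-- The pole is not a threefold axis. -/
lemma MaximalAtPole.one_seven_eq_zero {c : Fin 9 → ℝ} (hc : MaximalAtPole c) (hi : Isotropic c)
    (h4 : c 4 ≠ 0) (h3 : c 3 = 0) (h5 : c 5 = 0) (h2 : c 2 = 0) (h6 : c 6 = 0) :
    c 1 = 0 ∧ c 7 = 0 := by
  by_contra hne
  obtain ⟨e1, e2, e3, -, -⟩ := (isotropic_iff c).1 hi
  simp only [h3, h5, h2, h6] at e1 e2 e3
  have c4 := sq_pos_of_ne_zero h4
  have h17 : c 1 ^ 2 + c 7 ^ 2 ≠ 0 := by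
    contrapose! hne
    exact ⟨by nlinarith [sq_nonneg (c 1), sq_nonneg (c 7)],
      by nlinarith [sq_nonneg (c 1), sq_nonneg (c 7)]⟩
  have hprod : (c 0 ^ 2 + c 8 ^ 2) * (c 1 ^ 2 + c 7 ^ 2) = 0 := by
    linear_combination (c 0 * c 1 + c 8 * c 7) * e2 / 14 + (c 0 * c 7 - c 1 * c 8) * e3 / 14
  have h08 := (mul_eq_zero.1 hprod).resolve_right h17
  have h0 : c 0 = 0 := by nlinarith [sq_nonneg (c 0), sq_nonneg (c 8)]
  have h8 : c 8 = 0 := by nlinarith [sq_nonneg (c 0), sq_nonneg (c 8)]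
  obtain ⟨γ, hγ⟩ := exists_rotate_eq_zero (c 1) (c 7) (k := 3) (by norm_num)
  have hd := hc.Rz γ
  have hsq : (-Real.sin (3 * γ) * c 1 + Real.cos (3 * γ) * c 7) ^ 2 = c 1 ^ 2 + c 7 ^ 2 := by
    linear_combination (c 1 ^ 2 + c 7 ^ 2) * Real.cos_sq_add_sin_sq (3 * γ)
      - (Real.cos (3 * γ) * c 1 + Real.sin (3 * γ) * c 7) * hγ
  have hv {s : ℝ} (hs : s ^ 2 = 2) : (-28 * c 4 + 4 * √2 * √5 * √7
      * (-Real.sin (3 * γ) * c 1 + Real.cos (3 * γ) * c 7) * s) ^ 2 ≤ 5184 * c 4 ^ 2 := by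
    have e : (![s, 0, 1] : Fin 3 → ℝ) ⬝ᵥ ![s, 0, 1] = 3 := by
      simp only [dotProduct, Fin.sum_univ_three, Matrix.cons_val]
      linarith
    have b := hd ![s, 0, 1]
    rw [e, Rz_mulVec] at b
    simp only [quarticForm, Matrix.cons_val, h0, h8, h3, h5, h2, h6, hγ, hs] at b
    refine (le_of_eq ?_).trans (b.trans_eq ?_) <;> ring
  set d := -Real.sin (3 * γ) * c 1 + Real.cos (3 * γ) * c 7
  have hd2 : 7 * d ^ 2 = 20 * c 4 ^ 2 := by
    rw [h0, h8] at e1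
    linarith
  have b1 := hv sq_sqrt_two
  have b2 := hv ((neg_sq _).trans sq_sqrt_two)
  have hu : (√2 * √5 * √7 * √2) ^ 2 = 140 := by
    rw [mul_pow, mul_pow, mul_pow, sq_sqrt_two, sq_sqrt_five, sq_sqrt_seven]
    norm_num
  have hsum : (-28 * c 4 + 4 * √2 * √5 * √7 * d * √2) ^ 2
      + (-28 * c 4 + 4 * √2 * √5 * √7 * d * -√2) ^ 2 = 14368 * c 4 ^ 2 := by
    linear_combination 32 * d ^ 2 * hu + 640 * hd2
  linarith

lemma onOrbit_of_four_eight {c : Fin 9 → ℝ} (hn : c ⬝ᵥ c = 1) (hi : Isotropic c)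
    (h1 : c 1 = 0) (h2 : c 2 = 0) (h3 : c 3 = 0) (h5 : c 5 = 0) (h6 : c 6 = 0) (h7 : c 7 = 0) :
    ∃ θ d, (d = refVec ∨ d = -refVec) ∧ c = Rz θ *ᵥ d := by
  have e1 := ((isotropic_iff c).1 hi).1
  simp only [dotProduct, sum_univ_nine, h1, h2, h3, h5, h6, h7] at e1 hn
  have h4 : c 4 ^ 2 = √(7 / 12) ^ 2 := by rw [sq_sqrt_seven_div_twelve]; linarith
  have h08 : c 8 ^ 2 + c 0 ^ 2 = 5 / 12 := by linarith
  have h08' : (-c 8) ^ 2 + (-c 0) ^ 2 = 5 / 12 := by linarith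
  rcases sq_eq_sq_iff_eq_or_eq_neg.1 h4 with h | h
  · obtain ⟨θ, hx, hy⟩ := exists_polar (c 8) (c 0)
    rw [h08] at hx hy
    refine ⟨θ / 4, _, Or.inl rfl, ?_⟩
    rw [Rz_mulVec, mul_div_cancel₀ _ four_ne_zero]
    ext i
    fin_cases i <;> simp [refVec, h1, h2, h3, h5, h6, h7]
    · simpa [mul_comm] using hy
    · simpa using h
    · simpa [mul_comm] using hx
  · obtain ⟨θ, hx, hy⟩ := exists_polar (-c 8) (-c 0)
    rw [h08', sqrt_five_div_twelve] at hx hy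
    rw [sqrt_seven_div_twelve] at h
    refine ⟨θ / 4, _, Or.inr rfl, ?_⟩
    rw [Rz_mulVec, mul_div_cancel₀ _ four_ne_zero]
    ext i
    fin_cases i <;> simp [refVec, h1, h2, h3, h5, h6, h7]
    · linarith
    · linarith
    · linarith

lemma onOrbit_of_isotropic {a : Fin 9 → ℝ} (hn : a ⬝ᵥ a = 1) (ha : Isotropic a) : OnOrbit a := by
  obtain ⟨Q, M, h, hmax⟩ := exists_maximalAtPole a
  obtain ⟨γ, hγ⟩ := exists_rotate_eq_zero ((M *ᵥ a) 2) ((M *ᵥ a) 6) two_ne_zero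
  have hmax' := hmax.Rz γ
  have hN := (actsBy_rotZ γ).mul h
  set N := Rz γ * M
  set c := N *ᵥ a with hca
  rw [mulVec_mulVec] at hmax'
  have hcn : c ⬝ᵥ c = 1 := by rw [hN.dotProduct_mulVec, hn]
  have hci : Isotropic c := (hN.isotropic_iff a).2 ha
  have h4 := hmax'.ne_zero hcn
  have h5 := (mul_eq_zero.1 hmax'.critical.1).resolve_left h4
  have h3 := (mul_eq_zero.1 hmax'.critical.2).resolve_left h4
  have h2 : c 2 = 0 := by
    rw [hca, ← mulVec_mulVec, Rz_mulVec]
    exact hγ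
  have h6 := hmax'.six_eq_zero hci h4 h3 h5 h2
  obtain ⟨h1, h7⟩ := hmax'.one_seven_eq_zero hci h4 h3 h5 h2 h6
  obtain ⟨θ, d, hd, hcd⟩ := onOrbit_of_four_eight hcn hci h1 h2 h3 h5 h6 h7
  have e : a = (Nᵀ * Rz θ) *ᵥ d := by
    rw [← mulVec_mulVec, ← hcd, hca, mulVec_mulVec, mul_eq_one_comm.1 hN.mul_transpose, one_mulVec]
  rw [e]
  exact onOrbit_of_actsBy (hN.transpose.mul (actsBy_rotZ θ)) hd

lemma isSymm_S (k : Fin 5) : (S k).IsSymm := by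
  have h (c : ℝ) {M : Matrix (Fin 9) (Fin 9) ℝ} (hM : M.IsSymm) : (c • M).IsSymm := hM.smul c
  fin_cases k <;> refine h _ ?_ <;> ext i j <;> fin_cases i <;> fin_cases j <;> rfl

end OctahedralHarmonics

end

theorem lemma1 :
    (∀ k : Fin 5, (OctahedralHarmonics.S k).IsSymm) ∧
    {a : Fin 9 → ℝ | OctahedralHarmonics.IsNormalized (OctahedralHarmonics.harmonic a) ∧
        OctahedralHarmonics.HasOctahedralSymmetry (OctahedralHarmonics.harmonic a)} =
      {a : Fin 9 → ℝ | a ⬝ᵥ a = 1 ∧ ∀ k : Fin 5, a ⬝ᵥ (OctahedralHarmonics.S k *ᵥ a) = 0} ∧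
    {a : Fin 9 → ℝ | ∃ α β γ : ℝ,
        a = (OctahedralHarmonics.Rx α * OctahedralHarmonics.Ry β * OctahedralHarmonics.Rz γ) *ᵥ
            OctahedralHarmonics.refVec ∨
        a = -((OctahedralHarmonics.Rx α * OctahedralHarmonics.Ry β * OctahedralHarmonics.Rz γ) *ᵥ
            OctahedralHarmonics.refVec)} =
      {a : Fin 9 → ℝ | a ⬝ᵥ a = 1 ∧ ∀ k : Fin 5, a ⬝ᵥ (OctahedralHarmonics.S k *ᵥ a) = 0} := by
  refine ⟨OctahedralHarmonics.isSymm_S, Set.ext fun a => ⟨fun h => ?_, fun h => ?_⟩,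
    Set.ext fun a => ⟨fun h => OctahedralHarmonics.OnOrbit.isotropic h, fun h =>
      OctahedralHarmonics.onOrbit_of_isotropic h.1 h.2⟩⟩
  · have hn := (OctahedralHarmonics.isNormalized_iff a).1 h.1
    exact (OctahedralHarmonics.onOrbit_of_hasOctahedralSymmetry hn h.2).isotropic
  · exact ⟨(OctahedralHarmonics.isNormalized_iff a).2 h.1,
      (OctahedralHarmonics.onOrbit_of_isotropic h.1 h.2).hasOctahedralSymmetry⟩
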